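/- Let $G$ be a countable discrete group with identity $e$, let $P\subseteq G$ be a subsemigroup with $e\in P$ and $G=PP^{-1}$, and let $X$ be a second-countable compact Hausdorff space. Let $\theta$ be a right action of $P$ on $X$ by injective continuous maps $\theta_a:X\to X$ $(a\in P)$, that is, $\theta_a\theta_b=\theta_{ba}$ and $\theta_e=\mathrm{id}_X$, such that $\theta_a(X)$ is open in $X$ for every $a\in P$. For $x\in X$ let $Q_x$ be the set of all $g\in G$ of the form $g=ab^{-1}$ with $a,b\in P$ and $\theta_a(x)=\theta_b(y)$ for some $y\in X$; then $y$ depends only on $x$ and $g$, and is denoted $u(x,g)$. Let $\mathcal G=X\rtimes P=\{(x,g)\in X\times G: g\in Q_x\}$, with the relative product topology, be the transformation groupoid, with product $(x,g)(u(x,g),h)=(x,gh)$ and inverse $(x,g)^{-1}=(u(x,g),g^{-1})$. For a Hilbert $C(X)$-module $E$ let $\mathcal L(E)$ be the $C^*$-algebra of adjointable operators on $E$. (1) Let $l^2(\mathcal G)$ be the Hilbert $C(X)$-module obtained by completing $C_c(\mathcal G)$ for $\langle\xi,\eta\rangle(x)=\sum_{g\in Q_x}\overline{\xi(x,g)}\,\eta(x,g)$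 and $(\xi f)(x,g)=\xi(x,g)f(x)$. For $f\in C_c(\mathcal G)$ let $\tilde\pi(f)\in\mathcal L(l^2(\mathcal G))$ be given by $(\tilde\pi(f)\xi)(x,g)=\sum_{h\in Q_x}f(u(x,g),g^{-1}h)\,\xi(x,h)$. The reduced groupoid $C^*$-algebra $C^*_r(\mathcal G)$ is the $C^*$-algebra generated by $\tilde\pi(C_c(\mathcal G))$ in $\mathcal L(l^2(\mathcal G))$. (2) Let $l^2(P,C(X))$ be the Hilbert $C(X)$-module of all maps $\xi:P\to C(X)$ such that $\sum_{m\in P}|\xi(m)|^2$ converges in $C(X)$, with $\langle\xi,\eta\rangle=\sum_{m}\xi(m)^*\eta(m)$. Let $\alpha_m(f)=f\circ\theta_m$ be the dual action of $P$ on $C(X)$. For $f\in C(X)$ and $m\in P$ define $\pi(f),v_m\in\mathcal L(l^2(P,C(X)))$ by $(\pi(f)\xi)(n)=\alpha_n(f)\xi(n)$, and $(v_m\xi)(n)=\xi(nm^{-1})$ if $nm^{-1}\in P$, $(v_m\xi)(n)=0$ otherwise. The reduced crossed product $C(X)\rtimes_r P$ is the $C^*$-algebra generated by $\{\pi(f),v_m: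 f\in C(X),\,m\in P\}$ in $\mathcal L(l^2(P,C(X)))$. **Theorem.** Let $\mathcal M$ be the closure of $\{\xi\in C_c(\mathcal G):\ \xi(x,g)=0\text{ if }g\notin P\}$ in $l^2(\mathcal G)$. Then $\mathcal M$ is isomorphic to $l^2(P,C(X))$ as a Hilbert $C(X)$-module (there is a $C(X)$-linear bijection preserving the $C(X)$-valued inner products). There is a unique projection $Q=Q^*=Q^2\in\mathcal L(l^2(\mathcal G))$ with range $\mathcal M$, and $C(X)\rtimes_r P$ is $*$-isomorphic to the $C^*$-algebra generated by $Q\,C^*_r(\mathcal G)\,Q$ in $\mathcal L(l^2(\mathcal G))$. -/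

import Mathlib

open scoped ComplexOrder CompactlySupported

set_option linter.unusedSectionVars false

noncomputable section

/-! ### Adjointable operators on Hilbert `C⋆`-modules -/

section Adjointable

variable (A E : Type*) [NonUnitalCStarAlgebra A] [PartialOrder A] [StarOrderedRing A]
  [NormedAddCommGroup E] [NormedSpace ℂ E] [SMul A E] [CStarModule A E]

/-- The subalgebra of adjointable operators in the algebra of bounded operators on a Hilbert
`A`-module `E`. -/
def adjointableSubalgebra : Subalgebra ℂ (E →L[ℂ] E) where
  carrier := {T | ∃ S : E →L[ℂ] E, ∀ x y, inner A (S x) y = inner A x (T y)}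
  mul_mem' := by
    rintro T₁ T₂ ⟨S₁, h₁⟩ ⟨S₂, h₂⟩
    exact ⟨S₂ * S₁, fun x y => by simp [h₁, h₂]⟩
  add_mem' := by
    rintro T₁ T₂ ⟨S₁, h₁⟩ ⟨S₂, h₂⟩
    exact ⟨S₁ + S₂, fun x y => by simp [h₁, h₂]⟩
  algebraMap_mem' := fun c =>
    ⟨algebraMap ℂ _ (star c), fun x y => by simp [Algebra.algebraMap_eq_smul_one]⟩

/-- `𝓛(E)`: the algebra of adjointable operators on the Hilbert `A`-module `E`, with the operator
norm. -/
def Adjointable : Type _ := adjointableSubalgebra A E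

variable {A E}

theorem CStarModule.ext_inner {x y : E} (h : ∀ z, inner A z x = inner A z y) : x = y := by
  rw [← sub_eq_zero, ← CStarModule.inner_self (A := A)]
  simp [CStarModule.inner_sub_right, h]

namespace Adjointable

instance : NormedRing (Adjointable A E) := inferInstanceAs (NormedRing (adjointableSubalgebra A E))

instance : NormedAlgebra ℂ (Adjointable A E) :=
  inferInstanceAs (NormedAlgebra ℂ (adjointableSubalgebra A E))

variable (A E) in
/-- The inclusion of `𝓛(E)` in the bounded operators on `E`. -/
def toCLM : Adjointable A E →ₐ[ℂ] E →L[ℂ] E := (adjointableSubalgebra A E).val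

theorem toCLM_injective : Function.Injective (toCLM A E) := Subtype.val_injective

instance : CoeFun (Adjointable A E) fun _ => E → E := ⟨fun T => toCLM A E T⟩

/-- The adjointable operator `T` with adjoint `S`. -/
def mk (T S : E →L[ℂ] E) (h : ∀ x y, inner A (S x) y = inner A x (T y)) : Adjointable A E :=
  (⟨T, S, h⟩ : adjointableSubalgebra A E)

@[simp] theorem mk_apply (T S : E →L[ℂ] E) (h : ∀ x y, inner A (S x) y = inner A x (T y)) (x : E) :
    mk T S h x = T x := rfl

theorem exists_adjoint (T : Adjointable A E) :
    ∃ S : E →L[ℂ] E, ∀ x y, inner A (S x) y = inner A x (T y) := Subtype.property T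

/-- The adjoint of an adjointable operator. -/
instance : Star (Adjointable A E) where
  star T := mk T.exists_adjoint.choose (toCLM A E T) fun x y => by
    rw [← CStarModule.star_inner, ← T.exists_adjoint.choose_spec y x, CStarModule.star_inner]

theorem inner_star_left (T : Adjointable A E) (x y : E) :
    inner A ((star T : Adjointable A E) x) y = inner A x (T y) :=
  T.exists_adjoint.choose_spec x y

theorem inner_star_right (T : Adjointable A E) (x y : E) :
    inner A x ((star T : Adjointable A E) y) = inner A (T x) y := by
  rw [← CStarModule.star_inner, inner_star_left, CStarModule.star_inner]

@[ext] theorem ext {S T : Adjointable A E} (h : ∀ x, S x = T x) : S = T :=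
  toCLM_injective (ContinuousLinearMap.ext h)

theorem ext_of_inner {S T : Adjointable A E}
    (h : ∀ x y, inner A x (S y) = inner A x (T y)) : S = T :=
  ext fun y => CStarModule.ext_inner (A := A) fun x => h x y

@[simp] theorem add_apply (S T : Adjointable A E) (x : E) : (S + T) x = S x + T x := rfl
@[simp] theorem mul_apply (S T : Adjointable A E) (x : E) : (S * T) x = S (T x) := rfl
@[simp] theorem smul_apply (c : ℂ) (T : Adjointable A E) (x : E) : (c • T) x = c • T x := rfl

instance : StarRing (Adjointable A E) where
  star_involutive T := ext_of_inner fun x y => by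
    rw [inner_star_right, inner_star_left]
  star_mul S T := ext_of_inner fun x y => by
    rw [inner_star_right, mul_apply, mul_apply, inner_star_right, inner_star_right]
  star_add S T := ext_of_inner fun x y => by
    rw [inner_star_right, add_apply, add_apply, CStarModule.inner_add_left,
      CStarModule.inner_add_right, inner_star_right, inner_star_right]

instance : StarModule ℂ (Adjointable A E) where
  star_smul c T := ext_of_inner fun x y => by
    rw [inner_star_right, smul_apply, smul_apply, CStarModule.inner_smul_left_complex,
      CStarModule.inner_smul_right_complex, inner_star_right]

theorem norm_star_le (T : Adjointable A E) : ‖star T‖ ≤ ‖T‖ := by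
  refine ContinuousLinearMap.opNorm_le_bound (toCLM A E (star T)) (norm_nonneg T) fun x => ?_
  set y := (star T : Adjointable A E) x
  have h : ‖y‖ ^ 2 ≤ (‖T‖ * ‖x‖) * ‖y‖ := by
    rw [CStarModule.norm_sq_eq A, inner_star_left]
    calc _ ≤ ‖x‖ * ‖T y‖ := CStarModule.norm_inner_le E
      _ ≤ ‖x‖ * (‖T‖ * ‖y‖) := by gcongr; exact (toCLM A E T).le_opNorm y
      _ = _ := by ring
  by_contra! h'
  have hy : 0 < ‖y‖ := lt_of_le_of_lt (by positivity) h'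
  nlinarith

instance : NormedStarGroup (Adjointable A E) where
  norm_star_le := norm_star_le

end Adjointable

/-- The `C⋆`-algebra generated by a subset of `𝓛(E)`: the closure of the (not necessarily unital)
`⋆`-algebra generated by it. -/
def cstarGenerated (S : Set (Adjointable A E)) : NonUnitalStarSubalgebra ℂ (Adjointable A E) :=
  (NonUnitalStarAlgebra.adjoin ℂ S).topologicalClosure

/-- The Hilbert module structure on a submodule, by restriction. -/
instance Submodule.instCStarModule {A E : Type*} [CStarAlgebra A] [PartialOrder A]
    [StarOrderedRing A] [NormedAddCommGroup E] [NormedSpace ℂ E] [Module A E] [IsScalarTower ℂ A E]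
    [CStarModule A E] (N : Submodule A E) : CStarModule A N where
  inner x y := inner A (x : E) (y : E)
  inner_add_right := CStarModule.inner_add_right
  inner_self_nonneg := CStarModule.inner_self_nonneg
  inner_self := CStarModule.inner_self.trans (by simp)
  inner_op_smul_right := CStarModule.inner_op_smul_right
  inner_smul_right_complex := CStarModule.inner_smul_right_complex
  star_inner x y := CStarModule.star_inner (x : E) (y : E)
  norm_eq_sqrt_norm_inner_self x := CStarModule.norm_eq_sqrt_norm_inner_self (A := A) (x : E)

/-- The restriction of an adjointable operator `T` to a submodule that is invariant under both `T`
and its adjoint `S`. -/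
def Adjointable.restrict {A E : Type*} [CStarAlgebra A] [PartialOrder A]
    [StarOrderedRing A] [NormedAddCommGroup E] [NormedSpace ℂ E] [Module A E] [IsScalarTower ℂ A E]
    [CStarModule A E] (N : Submodule A E) (T S : E →L[ℂ] E)
    (hST : ∀ x y, inner A (S x) y = inner A x (T y))
    (hT : ∀ x ∈ N, T x ∈ N) (hS : ∀ x ∈ N, S x ∈ N) : Adjointable A N :=
  .mk
    { toFun := fun x => ⟨T x, hT x x.2⟩
      map_add' := fun x y => Subtype.ext (map_add T (x : E) y)
      map_smul' := fun c x => Subtype.ext (map_smul T c (x : E))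
      cont := (T.continuous.comp continuous_subtype_val).subtype_mk _ }
    { toFun := fun x => ⟨S x, hS x x.2⟩
      map_add' := fun x y => Subtype.ext (map_add S (x : E) y)
      map_smul' := fun c x => Subtype.ext (map_smul S c (x : E))
      cont := (S.continuous.comp continuous_subtype_val).subtype_mk _ }
    fun x y => hST x y

end Adjointable

/-! ### The Hilbert `C(X)`-module `ℓ²(I, C(X))` -/

section L2

variable {I J X : Type*} [TopologicalSpace X] [CompactSpace X]

theorem summable_of_sq_le {f g : I → C(X, ℂ)} (hg : Summable g)
    (h : ∀ i x, ‖f i x‖ ≤ (g i x).re) : Summable f ∧ ‖∑' i, f i‖ ≤ ‖∑' i, g i‖ := by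
  have key : ∀ t : Finset I, ‖∑ i ∈ t, f i‖ ≤ ‖∑ i ∈ t, g i‖ := fun t => by
    refine (ContinuousMap.norm_le _ (norm_nonneg _)).2 fun x => ?_
    calc ‖(∑ i ∈ t, f i) x‖ ≤ ∑ i ∈ t, ‖f i x‖ := by
          rw [ContinuousMap.sum_apply]; exact norm_sum_le _ _
      _ ≤ ∑ i ∈ t, (g i x).re := Finset.sum_le_sum fun i _ => h i x
      _ = ((∑ i ∈ t, g i) x).re := by rw [ContinuousMap.sum_apply, Complex.re_sum]
      _ ≤ ‖(∑ i ∈ t, g i) x‖ := Complex.re_le_norm _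
      _ ≤ _ := ContinuousMap.norm_coe_le_norm _ x
  have hf : Summable f := by
    rw [summable_iff_vanishing_norm] at hg ⊢
    intro ε hε
    obtain ⟨s, hs⟩ := hg ε hε
    exact ⟨s, fun t ht => (key t).trans_lt (hs t ht)⟩
  exact ⟨hf, le_of_tendsto_of_tendsto hf.hasSum.norm hg.hasSum.norm (Filter.Eventually.of_forall key)⟩

theorem star_mul_self_apply_re (f : C(X, ℂ)) (x : X) : ((star f * f) x).re = ‖f x‖ ^ 2 := by
  simp [← Complex.normSq_eq_norm_sq, Complex.normSq_apply]

variable (I X) in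
/-- The families `ξ : I → C(X)` for which `∑ |ξ i|²` converges in `C(X)`. -/
def l2Submodule : Submodule C(X, ℂ) (I → C(X, ℂ)) where
  carrier := {ξ | Summable fun i => star (ξ i) * ξ i}
  zero_mem' := by simp [summable_zero]
  add_mem' {ξ η} hξ hη := by
    refine (summable_of_sq_le (g := fun i => (2 : ℝ) • (star (ξ i) * ξ i) +
      (2 : ℝ) • (star (η i) * η i)) ((hξ.const_smul _).add (hη.const_smul _)) fun i x => ?_).1
    have h1 := star_mul_self_apply_re (ξ i) x
    have h2 := star_mul_self_apply_re (η i) x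
    have h3 : ‖(star ((ξ + η) i) * (ξ + η) i) x‖ = ‖ξ i x + η i x‖ ^ 2 := by
      rw [← CStarRing.norm_star_mul_self (x := ξ i x + η i x) |>.trans (sq _).symm]
      simp
    rw [h3]
    simp only [ContinuousMap.add_apply, ContinuousMap.smul_apply, Complex.add_re,
      Complex.smul_re, smul_eq_mul, h1, h2]
    nlinarith [norm_add_le (ξ i x) (η i x), norm_nonneg (ξ i x + η i x),
      sq_nonneg (‖ξ i x‖ - ‖η i x‖)]
  smul_mem' a ξ hξ := by
    have := hξ.mul_left (star a * a)
    refine this.congr fun i => ?_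
    simp only [Pi.smul_apply, smul_eq_mul, star_mul]
    ring

variable (I X) in
/-- `ℓ²(I, C(X))`: all families `ξ : I → C(X)` such that `∑ |ξ i|²` converges in `C(X)`. -/
structure L2 where
  /-- The underlying family. -/
  toFun : I → C(X, ℂ)
  mem : toFun ∈ l2Submodule I X

namespace L2

instance : CoeFun (L2 I X) fun _ => I → C(X, ℂ) := ⟨L2.toFun⟩

theorem toFun_injective : Function.Injective (L2.toFun : L2 I X → I → C(X, ℂ)) := by
  rintro ⟨_, _⟩ ⟨_, _⟩ rfl
  rfl

instance : Zero (L2 I X) := ⟨⟨0, zero_mem _⟩⟩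
instance : Add (L2 I X) := ⟨fun ξ η => ⟨ξ.1 + η.1, add_mem ξ.2 η.2⟩⟩
instance : Neg (L2 I X) := ⟨fun ξ => ⟨-ξ.1, neg_mem ξ.2⟩⟩
instance : Sub (L2 I X) := ⟨fun ξ η => ⟨ξ.1 - η.1, sub_mem ξ.2 η.2⟩⟩
instance : SMul ℕ (L2 I X) := ⟨fun n ξ => ⟨n • ξ.1, nsmul_mem ξ.2 n⟩⟩
instance : SMul ℤ (L2 I X) := ⟨fun n ξ => ⟨n • ξ.1, zsmul_mem ξ.2 n⟩⟩
instance : SMul C(X, ℂ) (L2 I X) := ⟨fun a ξ => ⟨a • ξ.1, Submodule.smul_mem _ a ξ.2⟩⟩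
instance : SMul ℂ (L2 I X) :=
  ⟨fun c ξ => ⟨c • ξ.1, Submodule.smul_of_tower_mem (l2Submodule I X) c ξ.2⟩⟩

instance : AddCommGroup (L2 I X) :=
  toFun_injective.addCommGroup _ rfl (fun _ _ => rfl) (fun _ => rfl) (fun _ _ => rfl)
    (fun _ _ => rfl) fun _ _ => rfl

instance : Module C(X, ℂ) (L2 I X) :=
  toFun_injective.module C(X, ℂ) ⟨⟨L2.toFun, rfl⟩, fun _ _ => rfl⟩ fun _ _ => rfl

instance : Module ℂ (L2 I X) :=
  toFun_injective.module ℂ ⟨⟨L2.toFun, rfl⟩, fun _ _ => rfl⟩ fun _ _ => rfl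

instance : IsScalarTower ℂ C(X, ℂ) (L2 I X) :=
  ⟨fun c a ξ => toFun_injective (smul_assoc c a ξ.1)⟩

@[ext] theorem ext {ξ η : L2 I X} (h : ∀ i, ξ i = η i) : ξ = η := toFun_injective (funext h)
@[simp] theorem add_apply (ξ η : L2 I X) (i : I) : (ξ + η) i = ξ i + η i := rfl
@[simp] theorem sub_apply (ξ η : L2 I X) (i : I) : (ξ - η) i = ξ i - η i := rfl
@[simp] theorem zero_apply (i : I) : (0 : L2 I X) i = 0 := rfl
@[simp] theorem smul_apply (c : ℂ) (ξ : L2 I X) (i : I) : (c • ξ) i = c • ξ i := rfl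
@[simp] theorem cmul_apply (a : C(X, ℂ)) (ξ : L2 I X) (i : I) : (a • ξ) i = a * ξ i := rfl

theorem summable_sq (ξ : L2 I X) : Summable fun i => star (ξ i) * ξ i := ξ.2

theorem summable_inner (ξ η : L2 I X) : Summable fun i => star (ξ i) * η i := by
  refine (summable_of_sq_le (ξ.summable_sq.add η.summable_sq) fun i x => ?_).1
  rw [ContinuousMap.add_apply, Complex.add_re, star_mul_self_apply_re, star_mul_self_apply_re]
  have : ‖(star (ξ i) * η i) x‖ = ‖ξ i x‖ * ‖η i x‖ := by simp
  rw [this]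
  nlinarith [sq_nonneg (‖ξ i x‖ - ‖η i x‖), norm_nonneg (ξ i x), norm_nonneg (η i x)]

instance : Inner C(X, ℂ) (L2 I X) := ⟨fun ξ η => ∑' i, star (ξ i) * η i⟩

/-- The norm `‖ξ‖ = ‖∑ |ξ i|²‖^{1/2}`. -/
instance : Norm (L2 I X) := CStarModule.norm C(X, ℂ)

theorem inner_def (ξ η : L2 I X) : inner C(X, ℂ) ξ η = ∑' i, star (ξ i) * η i := rfl

theorem inner_apply (ξ η : L2 I X) (x : X) :
    inner C(X, ℂ) ξ η x = ∑' i, star (ξ i x) * η i x := by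
  rw [inner_def, ← ContinuousMap.tsum_apply (summable_inner ξ η)]
  rfl

theorem sq_le_inner_self (ξ : L2 I X) (i : I) :
    star (ξ i) * ξ i ≤ inner C(X, ℂ) ξ ξ :=
  ξ.summable_sq.le_tsum i fun _ _ => star_mul_self_nonneg _

/-- The `C(X)`-valued inner product `⟨ξ, η⟩ = ∑ ξ(i)* η(i)`. -/
instance : CStarModule C(X, ℂ) (L2 I X) where
  inner_add_right {ξ η ζ} := by
    simp only [inner_def, add_apply, mul_add]
    exact (summable_inner _ _).tsum_add (summable_inner _ _)
  inner_self_nonneg := tsum_nonneg fun _ => star_mul_self_nonneg _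
  inner_self {ξ} := by
    refine ⟨fun h => ?_, fun h => by simp [h, inner_def]⟩
    ext1 i
    exact (CStarRing.star_mul_self_eq_zero_iff _).1
      (le_antisymm (h ▸ sq_le_inner_self ξ i) (star_mul_self_nonneg _))
  inner_op_smul_right {a ξ η} := by
    simp only [inner_def, cmul_apply, ← (summable_inner ξ η).tsum_mul_left]
    exact tsum_congr fun i => by ring
  inner_smul_right_complex {z ξ η} := by
    simp only [inner_def, smul_apply, mul_smul_comm]
    exact ((summable_inner ξ η).hasSum.const_smul z).tsum_eq
  star_inner ξ η := by
    simp only [inner_def]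
    rw [tsum_star]
    exact tsum_congr fun i => by simp [mul_comm]
  norm_eq_sqrt_norm_inner_self _ := rfl

instance : NormedAddCommGroup (L2 I X) := CStarModule.normedAddCommGroup C(X, ℂ)
instance : NormedSpace ℂ (L2 I X) := .ofCore (CStarModule.normedSpaceCore C(X, ℂ))

theorem le_of_sq_le {a b : ℝ} (h : a ^ 2 ≤ b ^ 2) (hb : 0 ≤ b) : a ≤ b :=
  (abs_le_of_sq_le_sq' h hb).2

theorem norm_sq_eq (ξ : L2 I X) : ‖ξ‖ ^ 2 = ‖∑' i, star (ξ i) * ξ i‖ :=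
  CStarModule.norm_sq_eq C(X, ℂ)

/-- A family dominated, up to a constant and an injective reindexing, by an element of `ℓ²`. -/
theorem mem_and_norm_le {j : I → J} (hj : j.Injective) (η : L2 J X) {ξ : I → C(X, ℂ)} {c : ℝ}
    (hc : 0 ≤ c) (h : ∀ i x, ‖ξ i x‖ ≤ c * ‖η (j i) x‖) :
    ∃ hξ : ξ ∈ l2Submodule I X, ‖(⟨ξ, hξ⟩ : L2 I X)‖ ≤ c * ‖η‖ := by
  have h1 : Summable fun i => star (η (j i)) * η (j i) :=
    η.summable_sq.comp_injective hj
  have h2 := summable_of_sq_le (f := fun i => star (ξ i) * ξ i) (h1.const_smul (c ^ 2))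
    fun i x => by
      have : ‖(star (ξ i) * ξ i) x‖ = ‖ξ i x‖ ^ 2 := by simp [sq]
      rw [this, ContinuousMap.smul_apply, Complex.smul_re, star_mul_self_apply_re, smul_eq_mul,
        ← mul_pow]
      exact pow_le_pow_left₀ (norm_nonneg _) (h i x) 2
  refine ⟨h2.1, le_of_sq_le (?_ : _ ≤ (c * ‖η‖) ^ 2) (by positivity)⟩
  have h3 : ‖∑' i, star (η (j i)) * η (j i)‖ ≤ ‖η‖ ^ 2 := by
    rw [norm_sq_eq]
    refine CStarAlgebra.norm_le_norm_of_nonneg_of_le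
      (tsum_nonneg fun _ => star_mul_self_nonneg _) ?_
    exact h1.tsum_le_tsum_of_inj j hj (fun _ _ => star_mul_self_nonneg _) (fun _ => le_rfl)
      η.summable_sq
  rw [norm_sq_eq, mul_pow]
  refine h2.2.trans ?_
  rw [h1.tsum_const_smul, norm_smul, Real.norm_of_nonneg (by positivity)]
  gcongr

theorem norm_apply_le (ξ : L2 I X) (i : I) : ‖ξ i‖ ≤ ‖ξ‖ := by
  refine le_of_sq_le (?_ : _ ≤ ‖ξ‖ ^ 2) (norm_nonneg _)
  rw [norm_sq_eq, sq, ← CStarRing.norm_star_mul_self]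
  exact CStarAlgebra.norm_le_norm_of_nonneg_of_le (star_mul_self_nonneg _) (sq_le_inner_self ξ i)

/-- The operator `ℓ²(J, C(X)) → ℓ²(I, C(X))`, `ξ ↦ (a i * ξ (j i))_i`, for an injective map
`j : I → J` and a bounded family `a`. -/
def mulPull (j : I → J) (hj : j.Injective) (a : I → C(X, ℂ)) (c : ℝ) (hc : 0 ≤ c)
    (ha : ∀ i, ‖a i‖ ≤ c) : L2 J X →L[ℂ] L2 I X :=
  have key (ξ : L2 J X) := mem_and_norm_le hj ξ (ξ := fun i => a i * ξ (j i)) hc fun i x => by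
    rw [ContinuousMap.mul_apply, norm_mul]
    gcongr
    exact ((a i).norm_coe_le_norm x).trans (ha i)
  LinearMap.mkContinuous
    { toFun := fun ξ => ⟨fun i => a i * ξ (j i), (key ξ).1⟩
      map_add' := fun ξ η => ext fun i => mul_add _ _ _
      map_smul' := fun z ξ => ext fun i => mul_smul_comm z (a i) (ξ (j i)) } c fun ξ => (key ξ).2

@[simp] theorem mulPull_apply (j : I → J) (hj : j.Injective) (a : I → C(X, ℂ)) (c : ℝ)
    (hc : 0 ≤ c) (ha : ∀ i, ‖a i‖ ≤ c) (ξ : L2 J X) (i : I) :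
    mulPull j hj a c hc ha ξ i = a i * ξ (j i) := rfl

/-- The isometry `ℓ²(I, C(X)) → ℓ²(J, C(X))` that transports a family along the injective map
`j : I → J` and extends it by zero. -/
def push (j : I → J) (hj : j.Injective) : L2 I X →L[ℂ] L2 J X :=
  have e (ξ : L2 I X) (k : J) :
      star (Function.extend j ξ.1 0 k) * Function.extend j ξ.1 0 k =
        Function.extend j (fun i => star (ξ i) * ξ i) 0 k := by
    by_cases h : ∃ i, j i = k
    · obtain ⟨i, rfl⟩ := h
      simp [hj.extend_apply]
    · simp [Function.extend_apply' _ _ _ h]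
  have s (ξ : L2 I X) : HasSum (fun k => star (Function.extend j ξ.1 0 k) *
      Function.extend j ξ.1 0 k) (∑' i, star (ξ i) * ξ i) := by
    simp only [e]
    exact (hasSum_extend_zero hj).2 ξ.summable_sq.hasSum
  LinearMap.mkContinuous
    { toFun := fun ξ => ⟨Function.extend j ξ.1 0, (s ξ).summable⟩
      map_add' := fun ξ η => ext fun k => by
        by_cases h : ∃ i, j i = k
        · obtain ⟨i, rfl⟩ := h
          simp only [add_apply, hj.extend_apply]
        · simp only [add_apply, Function.extend_apply' _ _ _ h, Pi.zero_apply, add_zero]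
      map_smul' := fun z ξ => ext fun k => by
        by_cases h : ∃ i, j i = k
        · obtain ⟨i, rfl⟩ := h
          simp only [smul_apply, hj.extend_apply, RingHom.id_apply]
        · simp only [smul_apply, Function.extend_apply' _ _ _ h, Pi.zero_apply, smul_zero] } 1 fun ξ => by
      rw [one_mul]
      refine le_of_sq_le (?_ : _ ≤ ‖ξ‖ ^ 2) (norm_nonneg _)
      rw [norm_sq_eq, norm_sq_eq, ← (s ξ).tsum_eq]
      rfl

@[simp] theorem push_apply (j : I → J) (hj : j.Injective) (ξ : L2 I X) (i : I) :
    push j hj ξ (j i) = ξ i := hj.extend_apply _ _ _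

theorem push_apply_of_notMem (j : I → J) (hj : j.Injective) (ξ : L2 I X) (k : J)
    (h : ¬ ∃ i, j i = k) : push j hj ξ k = 0 := Function.extend_apply' _ _ _ h

theorem inner_push (j : I → J) (hj : j.Injective) (ξ : L2 I X) (η : L2 J X) :
    inner C(X, ℂ) (push j hj ξ) η = ∑' i, star (ξ i) * η (j i) := by
  rw [inner_def, ← hj.tsum_eq]
  · simp
  · intro k hk
    by_contra h
    exact hk (by simp [push_apply_of_notMem j hj ξ k h])

/-- `push` composed with a multiplication operator is the adjoint of `mulPull`. -/
theorem inner_push_mulPull (j : I → J) (hj : j.Injective) (a : I → C(X, ℂ)) (c : ℝ) (hc : 0 ≤ c)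
    (ha : ∀ i, ‖a i‖ ≤ c) (ha' : ∀ i, ‖star (a i)‖ ≤ c) (η : L2 I X) (ξ : L2 J X) :
    inner C(X, ℂ) (push j hj (mulPull id Function.injective_id (fun i => star (a i)) c hc ha' η)) ξ
      = inner C(X, ℂ) η (mulPull j hj a c hc ha ξ) := by
  rw [inner_push, inner_def]
  exact tsum_congr fun i => by simp [mul_assoc, mul_left_comm]

instance : ContinuousConstSMul C(X, ℂ) (L2 I X) where
  continuous_const_smul a :=
    (mulPull id Function.injective_id (fun _ : I => a) ‖a‖ (norm_nonneg a)
      fun _ => le_rfl).continuous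

theorem norm_finset_sum_le (t : Finset I) (ξ : L2 I X) :
    ‖∑ i ∈ t, star (ξ i) * ξ i‖ ≤ ‖ξ‖ ^ 2 := by
  rw [norm_sq_eq]
  exact CStarAlgebra.norm_le_norm_of_nonneg_of_le
    (Finset.sum_nonneg fun _ _ => star_mul_self_nonneg _)
    (ξ.summable_sq.sum_le_tsum t fun _ _ => star_mul_self_nonneg _)

/-- `ℓ²(I, C(X))` is a Hilbert module, i.e. complete. -/
instance : CompleteSpace (L2 I X) := by
  refine Metric.complete_of_cauchySeq_tendsto fun ξ hξ => ?_
  have hc (i : I) : CauchySeq fun n => ξ n i := by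
    rw [Metric.cauchySeq_iff] at hξ ⊢
    intro ε hε
    obtain ⟨N, hN⟩ := hξ ε hε
    refine ⟨N, fun m hm n hn => lt_of_le_of_lt ?_ (hN m hm n hn)⟩
    rw [dist_eq_norm, dist_eq_norm]
    exact norm_apply_le (ξ m - ξ n) i
  choose η hη using fun i => cauchySeq_tendsto_of_complete (hc i)
  have tail (ε : ℝ) (hε : 0 < ε) : ∃ N, ∀ n ≥ N, ∀ t : Finset I,
      ‖∑ i ∈ t, star (ξ n i - η i) * (ξ n i - η i)‖ ≤ ε ^ 2 := by
    obtain ⟨N, hN⟩ := Metric.cauchySeq_iff.1 hξ ε hε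
    refine ⟨N, fun n hn t => ?_⟩
    have hl : Filter.Tendsto (fun m => ‖∑ i ∈ t, star (ξ n i - ξ m i) * (ξ n i - ξ m i)‖)
        Filter.atTop (nhds ‖∑ i ∈ t, star (ξ n i - η i) * (ξ n i - η i)‖) := by
      refine (tendsto_finsetSum _ fun i _ => ?_).norm
      have := (hη i).const_sub (ξ n i)
      exact this.star.mul this
    refine le_of_tendsto hl (Filter.eventually_atTop.2 ⟨N, fun m hm => ?_⟩)
    refine (norm_finset_sum_le t (ξ n - ξ m)).trans ?_
    have := (hN n hn m hm).le
    rw [dist_eq_norm] at this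
    exact pow_le_pow_left₀ (norm_nonneg _) this 2
  have diff (n : ℕ) (ε : ℝ)
      (h : ∀ t : Finset I, ‖∑ i ∈ t, star (ξ n i - η i) * (ξ n i - η i)‖ ≤ ε ^ 2)
      (t : Finset I) : ‖∑ i ∈ t, star (η i) * η i‖ ≤
        2 * ε ^ 2 + 2 * ‖∑ i ∈ t, star (ξ n i) * ξ n i‖ := by
    refine (ContinuousMap.norm_le _ (by positivity)).2 fun x => ?_
    have e1 := (ContinuousMap.norm_coe_le_norm _ x).trans (h t)
    have e2 := ContinuousMap.norm_coe_le_norm (∑ i ∈ t, star (ξ n i) * ξ n i) x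
    replace e1 := (Complex.re_le_norm _).trans e1
    replace e2 := (Complex.re_le_norm _).trans e2
    rw [ContinuousMap.sum_apply, Complex.re_sum] at e1 e2
    simp only [star_mul_self_apply_re] at e1 e2
    have e3 : ‖(∑ i ∈ t, star (η i) * η i) x‖ ≤ ∑ i ∈ t, ‖η i x‖ ^ 2 := by
      rw [ContinuousMap.sum_apply]
      exact (norm_sum_le _ _).trans_eq (Finset.sum_congr rfl fun i _ => by simp [sq])
    have e4 : ∑ i ∈ t, ‖η i x‖ ^ 2 ≤
        ∑ i ∈ t, (2 * ‖(ξ n i - η i) x‖ ^ 2 + 2 * ‖ξ n i x‖ ^ 2) := by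
      refine Finset.sum_le_sum fun i _ => ?_
      have := norm_sub_le (ξ n i x) (ξ n i x - η i x)
      rw [sub_sub_cancel] at this
      rw [ContinuousMap.sub_apply]
      nlinarith [norm_nonneg (η i x), sq_nonneg (‖ξ n i x‖ - ‖ξ n i x - η i x‖)]
    rw [Finset.sum_add_distrib, ← Finset.mul_sum, ← Finset.mul_sum] at e4
    linarith
  have hmem : η ∈ l2Submodule I X := by
    refine summable_iff_vanishing_norm.2 fun ε hε => ?_
    obtain ⟨N, hN⟩ := tail (Real.sqrt (ε / 8)) (by positivity)
    obtain ⟨s, hs⟩ := summable_iff_vanishing_norm.1 (ξ N).summable_sq (ε / 8) (by positivity)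
    refine ⟨s, fun t ht => ?_⟩
    have h1 := diff N _ (hN N le_rfl) t
    rw [Real.sq_sqrt (by positivity)] at h1
    have h2 := hs t ht
    linarith
  refine ⟨⟨η, hmem⟩, ?_⟩
  rw [Metric.tendsto_atTop]
  intro ε hε
  obtain ⟨N, hN⟩ := tail (ε / 2) (by positivity)
  refine ⟨N, fun n hn => ?_⟩
  rw [dist_eq_norm]
  have h1 : ‖ξ n - (⟨η, hmem⟩ : L2 I X)‖ ^ 2 ≤ (ε / 2) ^ 2 := by
    rw [norm_sq_eq]
    exact le_of_tendsto (summable_sq (ξ n - (⟨η, hmem⟩ : L2 I X))).hasSum.norm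
      (Filter.Eventually.of_forall (hN n hn))
  have := le_of_sq_le h1 (by positivity)
  linarith

/-- The restriction of an element of `ℓ²` to a finite set of indices. -/
theorem exists_finite_approx (ξ : L2 I X) {ε : ℝ} (hε : 0 < ε) :
    ∃ t : Finset I, ∃ η : L2 I X, (∀ i ∈ t, η i = ξ i) ∧ (∀ i ∉ t, η i = 0) ∧ ‖ξ - η‖ < ε := by
  classical
  obtain ⟨s, hs⟩ := summable_iff_vanishing_norm.1 ξ.summable_sq ((ε / 2) ^ 2) (by positivity)
  obtain ⟨h, -⟩ := mem_and_norm_le (ξ := fun i => if i ∈ s then ξ i else 0)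
    Function.injective_id ξ zero_le_one fun i x => by split_ifs <;> simp
  refine ⟨s, ⟨_, h⟩, fun i hi => if_pos hi, fun i hi => if_neg hi, ?_⟩
  set η : L2 I X := ⟨_, h⟩
  have h1 : ‖ξ - η‖ ^ 2 ≤ (ε / 2) ^ 2 := by
    rw [norm_sq_eq]
    refine le_of_tendsto (summable_sq (ξ - η)).hasSum.norm
      (Filter.Eventually.of_forall fun t => ?_)
    have : ∑ i ∈ t, star ((ξ - η) i) * (ξ - η) i = ∑ i ∈ t \ s, star (ξ i) * ξ i := by
      rw [Finset.sdiff_eq_filter, Finset.sum_filter]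
      refine Finset.sum_congr rfl fun i _ => ?_
      change star (ξ i - if i ∈ s then ξ i else 0) * (ξ i - if i ∈ s then ξ i else 0) = _
      by_cases hi : i ∈ s <;> simp [hi]
    rw [this]
    exact (hs _ Finset.sdiff_disjoint).le
  have := le_of_sq_le h1 (by positivity)
  linarith

end L2
end L2

/-! ### Injective actions and their transformation groupoids -/

/-- A submonoid `P` of a group `G` is right Ore if `G = P P⁻¹`. -/
class IsRightOre {G : Type*} [Group G] (P : Submonoid G) : Prop where
  exists_eq_mul_inv : ∀ g : G, ∃ a b : P, g = a * (b : G)⁻¹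

/-- A right action `θ` of `P` on the space `X` by injective continuous maps with open range. -/
structure InjectiveAction {G : Type*} [Group G] (P : Submonoid G) (X : Type*)
    [TopologicalSpace X] where
  /-- The map `θ_a`. -/
  toFun : P → X → X
  continuous' : ∀ a, Continuous (toFun a)
  injective' : ∀ a, Function.Injective (toFun a)
  comp' : ∀ a b x, toFun a (toFun b x) = toFun (b * a) x
  one' : ∀ x, toFun 1 x = x
  isOpen_range' : ∀ a, IsOpen (Set.range (toFun a))

/-- The extension by zero of a continuous function on a clopen set. -/
def clopenExtend {X : Type*} [TopologicalSpace X] (S : Set X) (hS : IsClopen S) (f : S → ℂ)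
    (hf : Continuous f) : C(X, ℂ) where
  toFun x := open scoped Classical in if h : x ∈ S then f ⟨x, h⟩ else 0
  continuous_toFun := by
    classical
    have h1 : ContinuousOn (fun x => if h : x ∈ S then f ⟨x, h⟩ else 0) S := by
      rw [continuousOn_iff_continuous_domRestrict]
      convert hf using 1
      ext x
      simp
    have h2 : ContinuousOn (fun x => if h : x ∈ S then f ⟨x, h⟩ else 0) Sᶜ :=
      continuousOn_const.congr fun x hx => dif_neg hx
    refine continuous_iff_continuousAt.2 fun x => ?_
    by_cases hx : x ∈ S
    · exact h1.continuousAt (hS.isOpen.mem_nhds hx)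
    · exact h2.continuousAt (hS.compl.isOpen.mem_nhds hx)

theorem clopenExtend_of_mem {X : Type*} [TopologicalSpace X] (S : Set X) (hS : IsClopen S)
    (f : S → ℂ) (hf : Continuous f) {x : X} (hx : x ∈ S) :
    clopenExtend S hS f hf x = f ⟨x, hx⟩ := dif_pos hx

theorem clopenExtend_of_notMem {X : Type*} [TopologicalSpace X] (S : Set X) (hS : IsClopen S)
    (f : S → ℂ) (hf : Continuous f) {x : X} (hx : x ∉ S) :
    clopenExtend S hS f hf x = 0 := dif_neg hx

namespace InjectiveAction

variable {G X : Type*} [Group G] [TopologicalSpace X] {P : Submonoid G} (θ : InjectiveAction P X)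

instance : CoeFun (InjectiveAction P X) fun _ => P → X → X := ⟨toFun⟩

/-- The dual action `α_m(f) = f ∘ θ_m` on `C(X)`. -/
def dual (m : P) (f : C(X, ℂ)) : C(X, ℂ) := f.comp ⟨θ m, θ.continuous' m⟩

/-- The set `Q_x` of all `g = a b⁻¹` with `θ_a(x) = θ_b(y)` for some `y`. -/
def Q (x : X) : Set G := {g | ∃ y, ∃ a b : P, g = a * (b : G)⁻¹ ∧ θ a x = θ b y}

/-- The point `u(x, g)` with `θ_a(x) = θ_b(u(x, g))` whenever `g = a b⁻¹`, for `g ∈ Q_x`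
(and `x` for other `g`). -/
def u (x : X) (g : G) : X := open scoped Classical in if h : g ∈ θ.Q x then h.choose else x

/-- The transformation groupoid `X ⋊ P`, as a topological space: a subspace of `X × G`. -/
def groupoid : Set (X × G) := {p | p.2 ∈ θ.Q p.1}

section Ore

variable [IsRightOre P]

theorem rel_of_eq {x y : X} {a b m n : P} (h : (a : G) * (b : G)⁻¹ = m * (n : G)⁻¹)
    (hxy : θ a x = θ b y) : θ m x = θ n y := by
  obtain ⟨p, q, hpq⟩ := IsRightOre.exists_eq_mul_inv (P := P) ((a : G)⁻¹ * m)
  have h1 : a * p = m * q := Subtype.ext <| by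
    have := congrArg (fun t => (a : G) * t * q) hpq
    simpa [mul_assoc] using this.symm
  have h2 : b * p = n * q := Subtype.ext <| by
    have h3 : (a : G) * p = m * q := congrArg Subtype.val h1
    have h4 : (b : G) = n * (m : G)⁻¹ * a := by
      have := congrArg (fun t => (n : G) * (m : G)⁻¹ * t * b) h
      simpa [mul_assoc] using this.symm
    calc (b : G) * p = n * (m : G)⁻¹ * (a * p) := by rw [h4]; group
      _ = n * q := by rw [h3]; group
  apply θ.injective' q
  rw [θ.comp', θ.comp', ← h1, ← h2, ← θ.comp', ← θ.comp', hxy]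

theorem mem_Q_iff (x : X) (a b : P) : (a : G) * (b : G)⁻¹ ∈ θ.Q x ↔ ∃ y, θ a x = θ b y := by
  constructor
  · rintro ⟨y, m, n, h, hy⟩
    exact ⟨y, θ.rel_of_eq h.symm hy⟩
  · rintro ⟨y, hy⟩
    exact ⟨y, a, b, rfl, hy⟩

theorem u_spec {x : X} {g : G} (hg : g ∈ θ.Q x) {a b : P} (h : g = a * (b : G)⁻¹) :
    θ a x = θ b (θ.u x g) := by
  rw [u, dif_pos hg]
  obtain ⟨m, n, h', hy⟩ := hg.choose_spec
  exact θ.rel_of_eq (h'.symm.trans h) hy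

theorem u_eq {x y : X} {a b : P} (h : θ a x = θ b y) : θ.u x (a * (b : G)⁻¹) = y :=
  θ.injective' b ((θ.u_spec ((θ.mem_Q_iff x a b).2 ⟨y, h⟩) rfl).symm.trans h)

theorem mem_Q_of_mem (x : X) (m : P) : (m : G) ∈ θ.Q x :=
  ⟨θ m x, m, 1, by simp, (θ.one' _).symm⟩

theorem mul_mem_Q {x : X} {g k : G} (hg : g ∈ θ.Q x) (hk : k ∈ θ.Q (θ.u x g)) :
    g * k ∈ θ.Q x := by
  obtain ⟨y, a, b, rfl, hy⟩ := hg
  rw [θ.u_eq hy] at hk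
  obtain ⟨z, c, d, rfl, hz⟩ := hk
  obtain ⟨m, n, hmn⟩ := IsRightOre.exists_eq_mul_inv (P := P) ((b : G)⁻¹ * c)
  have h1 : c * n = b * m := Subtype.ext <| by
    have := congrArg (fun t => (b : G) * t * n) hmn
    simpa [mul_assoc] using this
  refine ⟨z, a * m, d * n, ?_, ?_⟩
  · calc (a : G) * (b : G)⁻¹ * (c * (d : G)⁻¹) = a * ((b : G)⁻¹ * c) * (d : G)⁻¹ := by group
      _ = _ := by rw [hmn]; push_cast; group
  · rw [← θ.comp', hy, θ.comp', ← h1, ← θ.comp', hz, θ.comp']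

theorem inv_mul_mem_Q {x : X} {g h : G} (hg : g ∈ θ.Q x) (hh : h ∈ θ.Q x) :
    g⁻¹ * h ∈ θ.Q (θ.u x g) := by
  obtain ⟨y, a, b, rfl, hy⟩ := hg
  rw [θ.u_eq hy]
  have e : ((a : G) * (b : G)⁻¹)⁻¹ = b * (a : G)⁻¹ := by group
  rw [e]
  apply θ.mul_mem_Q ((θ.mem_Q_iff y b a).2 ⟨x, hy.symm⟩)
  rwa [θ.u_eq hy.symm]

variable [CompactSpace X] [T2Space X]

theorem isClopen_setOf_mem_Q (g : G) : IsClopen {x | g ∈ θ.Q x} := by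
  obtain ⟨a, b, rfl⟩ := IsRightOre.exists_eq_mul_inv (P := P) g
  have : {x | (a : G) * (b : G)⁻¹ ∈ θ.Q x} = θ a ⁻¹' Set.range (θ b) := by
    ext x
    rw [Set.mem_ofPred_eq, θ.mem_Q_iff]
    exact exists_congr fun _ => eq_comm
  rw [this]
  exact IsClopen.preimage ⟨(isCompact_range (θ.continuous' b)).isClosed, θ.isOpen_range' b⟩
    (θ.continuous' a)

theorem continuous_u (g : G) : Continuous fun x : {x | g ∈ θ.Q x} => θ.u x g := by
  obtain ⟨a, b, rfl⟩ := IsRightOre.exists_eq_mul_inv (P := P) g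
  have hb : Topology.IsClosedEmbedding (θ b) :=
    (θ.continuous' b).isClosedEmbedding (θ.injective' b)
  rw [hb.isInducing.continuous_iff]
  exact ((θ.continuous' a).comp continuous_subtype_val).congr fun x => θ.u_spec x.2 rfl

/-- `V_g(f)(x) = f(u(x, g))` if `g ∈ Q_x`, and `0` otherwise. -/
def V (g : G) (f : C(X, ℂ)) : C(X, ℂ) :=
  clopenExtend {x | g ∈ θ.Q x} (θ.isClopen_setOf_mem_Q g) (fun x => f (θ.u x g))
    (f.continuous.comp (θ.continuous_u g))

theorem V_apply {g : G} {x : X} (h : g ∈ θ.Q x) (f : C(X, ℂ)) : θ.V g f x = f (θ.u x g) :=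
  clopenExtend_of_mem {x | g ∈ θ.Q x} _ _ _ h

theorem V_apply_of_notMem {g : G} {x : X} (h : g ∉ θ.Q x) (f : C(X, ℂ)) : θ.V g f x = 0 :=
  clopenExtend_of_notMem {x | g ∈ θ.Q x} _ _ _ h

theorem norm_V_le (g : G) (f : C(X, ℂ)) : ‖θ.V g f‖ ≤ ‖f‖ := by
  refine (ContinuousMap.norm_le _ (norm_nonneg f)).2 fun x => ?_
  by_cases h : g ∈ θ.Q x
  · rw [θ.V_apply h]
    exact f.norm_coe_le_norm _
  · simp [θ.V_apply_of_notMem h]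

variable [TopologicalSpace G]

/-- The function `x ↦ ξ(x, g)`, extended by zero, for `ξ ∈ C_c(X ⋊ P)`. -/
def coeff (ξ : C_c(θ.groupoid, ℂ)) (g : G) : C(X, ℂ) :=
  clopenExtend {x | g ∈ θ.Q x} (θ.isClopen_setOf_mem_Q g) (fun x => ξ ⟨(x.1, g), x.2⟩)
    (ξ.continuous_toFun.comp
      ((continuous_subtype_val.prodMk continuous_const).subtype_mk fun x => x.2))

theorem coeff_apply (ξ : C_c(θ.groupoid, ℂ)) {g : G} {x : X} (h : g ∈ θ.Q x) :
    θ.coeff ξ g x = ξ ⟨(x, g), h⟩ :=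
  clopenExtend_of_mem {x | g ∈ θ.Q x} _ _ _ h

theorem coeff_apply_of_notMem (ξ : C_c(θ.groupoid, ℂ)) {g : G} {x : X} (h : g ∉ θ.Q x) :
    θ.coeff ξ g x = 0 :=
  clopenExtend_of_notMem {x | g ∈ θ.Q x} _ _ _ h

theorem coeff_ext {ξ : C_c(θ.groupoid, ℂ)} {η : G → C(X, ℂ)}
    (h : ∀ (x : X) (g : G) (hg : g ∈ θ.Q x), ξ ⟨(x, g), hg⟩ = η g x)
    (h' : ∀ (x : X) (g : G), g ∉ θ.Q x → η g x = 0) : θ.coeff ξ = η := by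
  ext g x
  by_cases hg : g ∈ θ.Q x
  · rw [θ.coeff_apply ξ hg, h]
  · rw [θ.coeff_apply_of_notMem ξ hg, h' x g hg]

variable [DiscreteTopology G]

theorem finite_support_coeff (ξ : C_c(θ.groupoid, ℂ)) : {g | θ.coeff ξ g ≠ 0}.Finite := by
  have h : ((fun p : θ.groupoid => p.1.2) '' tsupport ξ).Finite :=
    (ξ.hasCompactSupport.isCompact.image
      (continuous_snd.comp continuous_subtype_val)).finite_of_discrete
  refine h.subset fun g hg => ?_
  obtain ⟨x, hx⟩ := DFunLike.ne_iff.1 hg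
  by_cases hgx : g ∈ θ.Q x
  · rw [θ.coeff_apply ξ hgx] at hx
    exact ⟨⟨(x, g), hgx⟩, subset_tsupport _ hx, rfl⟩
  · exact absurd (θ.coeff_apply_of_notMem ξ hgx) hx

/-- The inclusion of `C_c(X ⋊ P)` in `ℓ²(G, C(X))`, extending functions by zero. -/
def toL2 : C_c(θ.groupoid, ℂ) →ₗ[ℂ] L2 G X where
  toFun ξ := ⟨θ.coeff ξ, summable_of_hasFiniteSupport <| (θ.finite_support_coeff ξ).subset
    fun g hg => by
      contrapose! hg
      simp only [Set.mem_ofPred_eq, not_not] at hg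
      simp [hg]⟩
  map_add' ξ η := L2.ext fun g => congrFun (θ.coeff_ext (η := θ.coeff ξ + θ.coeff η)
    (fun x g hg => by simp [θ.coeff_apply _ hg])
    (fun x g hg => by simp [θ.coeff_apply_of_notMem _ hg])) g
  map_smul' z ξ := L2.ext fun g => congrFun (θ.coeff_ext (η := z • θ.coeff ξ)
    (fun x g hg => by simp [θ.coeff_apply _ hg])
    (fun x g hg => by simp [θ.coeff_apply_of_notMem _ hg])) g

@[simp] theorem toL2_apply (ξ : C_c(θ.groupoid, ℂ)) (g : G) : θ.toL2 ξ g = θ.coeff ξ g := rfl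

/-- On `C_c(X ⋊ P)`, the inner product of `ℓ²(G, C(X))` is
`⟨ξ, η⟩(x) = ∑_{g ∈ Q_x} conj ξ(x, g) η(x, g)`. -/
theorem inner_toL2_apply (ξ η : C_c(θ.groupoid, ℂ)) (x : X) :
    inner C(X, ℂ) (θ.toL2 ξ) (θ.toL2 η) x =
      ∑' g : θ.Q x, star (ξ ⟨(x, g), g.2⟩) * η ⟨(x, g), g.2⟩ := by
  rw [L2.inner_apply, ← tsum_subtype_eq_of_support_subset (s := θ.Q x)]
  · exact tsum_congr fun g => by simp [θ.coeff_apply _ g.2]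
  · intro g hg
    by_contra h
    exact hg (by simp [θ.coeff_apply_of_notMem _ h])

/-- The `C(X)`-action `(ξ f)(x, g) = ξ(x, g) f(x)` on `C_c(X ⋊ P)`. -/
def smulCc (f : C(X, ℂ)) (ξ : C_c(θ.groupoid, ℂ)) : C_c(θ.groupoid, ℂ) :=
  (f.comp ⟨fun p : θ.groupoid => p.1.1, by fun_prop⟩ : C(θ.groupoid, ℂ)) • ξ

theorem toL2_smulCc (f : C(X, ℂ)) (ξ : C_c(θ.groupoid, ℂ)) :
    θ.toL2 (θ.smulCc f ξ) = f • θ.toL2 ξ :=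
  L2.ext fun g => congrFun (θ.coeff_ext (η := f • θ.coeff ξ)
    (fun x g hg => by simp [θ.coeff_apply _ hg, smulCc])
    (fun x g hg => by simp [θ.coeff_apply_of_notMem _ hg])) g

/-- The image of `C_c(X ⋊ P)` in `ℓ²(G, C(X))`. -/
def ccSubmodule : Submodule C(X, ℂ) (L2 G X) where
  carrier := Set.range θ.toL2
  zero_mem' := ⟨0, map_zero _⟩
  add_mem' := by
    rintro _ _ ⟨ξ, rfl⟩ ⟨η, rfl⟩
    exact ⟨ξ + η, map_add _ _ _⟩
  smul_mem' := by
    rintro f _ ⟨ξ, rfl⟩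
    exact ⟨θ.smulCc f ξ, θ.toL2_smulCc f ξ⟩

/-- The Hilbert `C(X)`-module `ℓ²(X ⋊ P)`: the completion of `C_c(X ⋊ P)` for the inner product
`⟨ξ, η⟩(x) = ∑_{g ∈ Q_x} conj ξ(x, g) η(x, g)`, realized as the closure of `C_c(X ⋊ P)` in the
complete module `ℓ²(G, C(X))`, whose inner product restricts to this one (`inner_toL2_apply`). -/
def l2Groupoid : Submodule C(X, ℂ) (L2 G X) := θ.ccSubmodule.topologicalClosure

instance : CompleteSpace θ.l2Groupoid :=
  (Submodule.isClosed_topologicalClosure θ.ccSubmodule).completeSpace_coe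

theorem mem_l2Groupoid_iff (ξ : L2 G X) :
    ξ ∈ θ.l2Groupoid ↔ ∀ (g : G) (x : X), g ∉ θ.Q x → ξ g x = 0 := by
  constructor
  · intro hξ g x hg
    have hc : Continuous fun ξ : L2 G X => ξ g x := by
      refine Continuous.comp (g := fun f : C(X, ℂ) => f x) (by fun_prop) ?_
      refine continuous_iff_continuousAt.2 fun ξ => ?_
      refine Metric.continuousAt_iff.2 fun ε hε => ⟨ε, hε, fun {η} h => ?_⟩
      rw [dist_eq_norm] at h ⊢
      exact (L2.norm_apply_le (η - ξ) g).trans_lt h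
    have hs : IsClosed {ξ : L2 G X | ξ g x = 0} := isClosed_eq hc continuous_const
    refine closure_minimal (s := Set.range θ.toL2) ?_ hs hξ
    rintro _ ⟨η, rfl⟩
    exact θ.coeff_apply_of_notMem η hg
  · intro h
    refine Metric.mem_closure_iff.2 fun ε hε => ?_
    obtain ⟨t, η, ht, ht', hη⟩ := L2.exists_finite_approx ξ hε
    refine ⟨η, ?_, by rwa [dist_eq_norm]⟩
    have hcl : IsClosed θ.groupoid := by
      have : IsOpen θ.groupoidᶜ := by
        refine isOpen_iff_mem_nhds.2 fun p hp => ?_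
        have h1 : {x | p.2 ∈ θ.Q x}ᶜ ×ˢ {p.2} ∈ nhds p :=
          prod_mem_nhds ((θ.isClopen_setOf_mem_Q p.2).compl.isOpen.mem_nhds hp)
            (by simp [nhds_discrete])
        refine Filter.mem_of_superset h1 ?_
        rintro ⟨x, g⟩ ⟨hx, rfl⟩
        exact hx
      exact isOpen_compl_iff.1 this
    have hcont : Continuous fun p : θ.groupoid => η p.1.2 p.1.1 := by
      have : Continuous fun p : X × G => η p.2 p.1 :=
        continuous_prod_of_discrete_right.2 fun g => (η g).continuous
      exact this.comp continuous_subtype_val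
    refine ⟨⟨⟨_, hcont⟩, ?_⟩, ?_⟩
    · refine HasCompactSupport.intro (K := Subtype.val ⁻¹' (Set.univ ×ˢ (t : Set G))) ?_ ?_
      · exact hcl.isClosedEmbedding_subtypeVal.isCompact_preimage
          (isCompact_univ.prod t.finite_toSet.isCompact)
      · intro p hp
        have : p.1.2 ∉ t := fun hpt => hp ⟨trivial, hpt⟩
        simp [ht' _ this]
    · refine L2.ext fun g => congrFun (θ.coeff_ext (η := η.toFun) (fun x g hg => rfl) ?_) g
      intro x g hg
      by_cases hgt : g ∈ t
      · rw [ht g hgt, h g x hg]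
      · rw [ht' g hgt]; rfl

/-! ### The reduced groupoid `C⋆`-algebra -/

/-- The part `ξ ↦ ((x, g) ↦ f(u(x, g), k) ξ(x, g k))` of `π̃(f)`. -/
def regularPart (f : C_c(θ.groupoid, ℂ)) (k : G) : Adjointable C(X, ℂ) θ.l2Groupoid :=
  Adjointable.restrict θ.l2Groupoid
    (L2.mulPull (· * k) (mul_left_injective k) (fun g => θ.V g (θ.coeff f k)) ‖θ.coeff f k‖
      (norm_nonneg _) fun g => θ.norm_V_le g _)
    ((L2.push (· * k) (mul_left_injective k)).comp
      (L2.mulPull id Function.injective_id (fun g => star (θ.V g (θ.coeff f k))) ‖θ.coeff f k‖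
        (norm_nonneg _) fun g => (norm_star _).trans_le (θ.norm_V_le g _)))
    (fun _ _ => L2.inner_push_mulPull _ _ _ _ _ _ _ _ _)
    (fun ξ hξ => by
      rw [mem_l2Groupoid_iff] at hξ ⊢
      intro g x hg
      simp [θ.V_apply_of_notMem hg])
    (fun ξ hξ => by
      rw [mem_l2Groupoid_iff] at hξ ⊢
      intro g x hg
      obtain ⟨g, rfl⟩ : ∃ g', g' * k = g := ⟨g * k⁻¹, by group⟩
      have e := L2.push_apply (· * k) (mul_left_injective k)
        (L2.mulPull id Function.injective_id (fun g => star (θ.V g (θ.coeff f k))) ‖θ.coeff f k‖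
        (norm_nonneg _) (fun g => (norm_star _).trans_le (θ.norm_V_le g _)) ξ) g
      rw [ContinuousLinearMap.comp_apply, e, L2.mulPull_apply, id, ContinuousMap.mul_apply]
      by_cases h : g ∈ θ.Q x
      · have : k ∉ θ.Q (θ.u x g) := fun hk => hg (θ.mul_mem_Q h hk)
        simp [θ.V_apply h, θ.coeff_apply_of_notMem f this]
      · simp [hξ g x h])

/-- The regular representation `π̃` of `C_c(X ⋊ P)` on `ℓ²(X ⋊ P)`:
`(π̃(f)ξ)(x, g) = ∑_{h ∈ Q_x} f(u(x, g), g⁻¹ h) ξ(x, h)` (see `regular_apply`), where the sum is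
written over `k = g⁻¹ h`. -/
def regular (f : C_c(θ.groupoid, ℂ)) : Adjointable C(X, ℂ) θ.l2Groupoid :=
  ∑ k ∈ (θ.finite_support_coeff f).toFinset, θ.regularPart f k

theorem regular_apply (f : C_c(θ.groupoid, ℂ)) (ξ : θ.l2Groupoid) {x : X} {g : G}
    (hg : g ∈ θ.Q x) : (θ.regular f ξ).1 g x =
      ∑' h : θ.Q x, f ⟨(θ.u x g, g⁻¹ * h), θ.inv_mul_mem_Q hg h.2⟩ * ξ.1 h x := by
  classical
  have e1 : (θ.regular f ξ).1 g x = ∑ k ∈ (θ.finite_support_coeff f).toFinset,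
      θ.coeff f k (θ.u x g) * ξ.1 (g * k) x := by
    rw [regular]
    induction (θ.finite_support_coeff f).toFinset using Finset.induction_on with
    | empty => simp
    | insert k s hk ih =>
      rw [Finset.sum_insert hk, Finset.sum_insert hk, ← ih, Adjointable.add_apply,
        ← θ.V_apply hg]
      rfl
  have e2 : ∑ k ∈ (θ.finite_support_coeff f).toFinset,
      θ.coeff f k (θ.u x g) * ξ.1 (g * k) x =
      ∑' k, θ.coeff f k (θ.u x g) * ξ.1 (g * k) x := by
    refine (tsum_eq_sum fun k hk => ?_).symm
    simp only [Set.Finite.mem_toFinset, Set.mem_ofPred_eq, not_not] at hk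
    simp [hk]
  rw [e1, e2, ← (Equiv.mulLeft g⁻¹).tsum_eq, ← tsum_subtype_eq_of_support_subset (s := θ.Q x)]
  · exact tsum_congr fun h => by
      simp [← θ.coeff_apply f (θ.inv_mul_mem_Q hg h.2)]
  · intro h hh
    by_contra hn
    apply hh
    simp [(θ.mem_l2Groupoid_iff _).1 ξ.2 h x hn]

/-- The reduced groupoid `C⋆`-algebra `C⋆_r(X ⋊ P) ⊆ 𝓛(ℓ²(X ⋊ P))`. -/
def reducedGroupoidCStar : NonUnitalStarSubalgebra ℂ (Adjointable C(X, ℂ) θ.l2Groupoid) :=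
  cstarGenerated (Set.range θ.regular)

/-- The submodule `𝓜` of `ℓ²(X ⋊ P)`: the closure of the set of all `ξ ∈ C_c(X ⋊ P)` such that
`ξ(x, g) = 0` if `g ∉ P`. -/
def M : Submodule C(X, ℂ) θ.l2Groupoid where
  carrier := closure {ζ | ∃ ξ : C_c(θ.groupoid, ℂ),
    (∀ p : θ.groupoid, p.1.2 ∉ P → ξ p = 0) ∧ (ζ : L2 G X) = θ.toL2 ξ}
  zero_mem' := subset_closure ⟨0, fun _ _ => rfl, by simp⟩
  add_mem' {a b} ha hb := by
    refine map_mem_closure₂ continuous_add ha hb ?_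
    rintro a ⟨ξ, hξ, ha⟩ b ⟨η, hη, hb⟩
    exact ⟨ξ + η, fun p hp => by simp [hξ p hp, hη p hp], by simp [ha, hb]⟩
  smul_mem' f {a} ha := by
    refine map_mem_closure (f := fun ζ : θ.l2Groupoid => f • ζ) ?_ ha ?_
    · exact ((continuous_const_smul f).comp continuous_subtype_val).subtype_mk _
    · rintro a ⟨ξ, hξ, ha⟩
      refine ⟨θ.smulCc f ξ, fun p hp => by simp [smulCc, hξ p hp], ?_⟩
      rw [toL2_smulCc, ← ha]
      rfl

end Ore

/-! ### The reduced semigroup crossed product -/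

section CrossedProduct

variable [CompactSpace X]

/-- `(π(f)ξ)(m) = α_m(f) ξ(m)` on `ℓ²(P, C(X))`. -/
def piRep (f : C(X, ℂ)) : Adjointable C(X, ℂ) (L2 P X) :=
  have h (m : P) : ‖θ.dual m f‖ ≤ ‖f‖ :=
    (ContinuousMap.norm_le _ (norm_nonneg f)).2 fun x => f.norm_coe_le_norm _
  have h' (m : P) : ‖star (θ.dual m f)‖ ≤ ‖f‖ := (norm_star _).trans_le (h m)
  .mk (L2.mulPull id Function.injective_id (fun m => θ.dual m f) ‖f‖ (norm_nonneg f) h)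
    (L2.mulPull id Function.injective_id (fun m => star (θ.dual m f)) ‖f‖ (norm_nonneg f) h')
    fun ξ η => by
      rw [L2.inner_def, L2.inner_def]
      exact tsum_congr fun i => by simp [mul_assoc, mul_left_comm]

theorem piRep_apply (f : C(X, ℂ)) (ξ : L2 P X) (m : P) :
    θ.piRep f ξ m = θ.dual m f * ξ m := rfl

theorem mul_right_injective (m : P) : Function.Injective fun n : P => n * m :=
  fun _ _ h => Subtype.ext (mul_right_cancel (congrArg Subtype.val h))

variable (X) in
/-- The isometry `(v_m ξ)(n) = ξ(n m⁻¹)` on `ℓ²(P, C(X))`, where `ξ` is extended by zero to `G`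
(see `v_apply`); its adjoint is `(v_m⋆ ξ)(n) = ξ(n m)`. -/
def v (m : P) : Adjointable C(X, ℂ) (L2 P X) :=
  .mk (L2.push (· * m) (mul_right_injective m))
    (L2.mulPull (· * m) (mul_right_injective m) (fun _ => 1) ‖(1 : C(X, ℂ))‖ (norm_nonneg _)
      fun _ => le_rfl)
    fun ξ η => by
      rw [← CStarModule.star_inner, ← CStarModule.star_inner ((L2.push _ (mul_right_injective m)) η), L2.inner_push,
        L2.inner_def]
      exact congrArg star (tsum_congr fun i => by simp)

open scoped Classical in
theorem v_apply (m n : P) (ξ : L2 P X) :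
    v X m ξ n = if h : (n : G) * (m : G)⁻¹ ∈ P then ξ ⟨_, h⟩ else 0 := by
  split_ifs with h
  · have : n = (⟨_, h⟩ : P) * m := Subtype.ext (by simp)
    conv_lhs => rw [this]
    exact L2.push_apply _ (mul_right_injective m) _ _
  · refine L2.push_apply_of_notMem _ (mul_right_injective m) _ _ ?_
    rintro ⟨k, rfl⟩
    exact h (by simp)

/-- The reduced crossed product `C(X) ⋊_r P` of the dual action. -/
def reducedCrossedProduct : NonUnitalStarSubalgebra ℂ (Adjointable C(X, ℂ) (L2 P X)) :=
  cstarGenerated (Set.range θ.piRep ∪ Set.range (v X))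

end CrossedProduct

end InjectiveAction

end

/-! An element of `ℓ²(X ⋊ P)` is a family indexed by `G` whose entry at `g` vanishes off the clopen
set of all `x` with `g ∈ Q_x`. For `m ∈ P` this condition is void, since `m ∈ Q_x` for every `x`.
Hence extension by zero `embed : ℓ²(P, C(X)) → ℓ²(X ⋊ P)` is an isometry with range `𝓜`, its adjoint
`restr` is restriction to `P`, and `embed ∘ restr` is the projection `Q` onto `𝓜` (`mem_M_iff`,
`inner_embed`, `range_projM`). A projection is determined by its range, so it is unique.

For the algebras, the right operators are the monomials `(T ξ)(x, g) = h(u(x, g)) ξ(x, g k)`. They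
are closed under products (`IsMonomial.mul`), they include the adjoints that are needed
(`regularPart_star_isMonomial`), and so they span the `⋆`-algebra generated by `π̃(C_c)`
(`mem_span_isMonomial`). If `k = a b⁻¹` with `a, b ∈ P`, the compression of such a `T` to `ℓ²(P,
C(X))` is `π(h) v_a⋆ v_b` (`IsMonomial.compression`). Therefore every compression lies in the
crossed product. Conversely `π(f)` and `v_m` are themselves compressions, of operators `π̃(F)` with
`F` supported over `k = e` and over `k = m⁻¹`.

Conjugation by the isometry `embed` is an injective `⋆`-homomorphism that sends `restr T embed` to
`Q T Q`, and this carries one generated `C⋆`-algebra onto the other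
(`nonempty_equiv_cstarGenerated_compression`). Since compression is not multiplicative, `Q C⋆_r Q`
is only treated as a set of generators. -/

noncomputable section

/-! ### Compression of adjointable operators along an isometry -/

section Compression

variable {A E F : Type*} [NonUnitalCStarAlgebra A] [PartialOrder A] [StarOrderedRing A]
  [NormedAddCommGroup E] [NormedSpace ℂ E] [SMul A E] [CStarModule A E]
  [NormedAddCommGroup F] [NormedSpace ℂ F] [SMul A F] [CStarModule A F]

theorem CStarModule.inner_comm_adjoint {U : E →L[ℂ] F} {V : F →L[ℂ] E}
    (h : ∀ y x, inner A (V y) x = inner A y (U x)) (x : E) (y : F) :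
    inner A (U x) y = inner A x (V y) := by
  rw [← CStarModule.star_inner, ← h, CStarModule.star_inner]

namespace Adjointable

/-- The star is defined by choosing an adjoint; uniqueness of adjoints is what makes it computable
from an explicit formula. -/
theorem star_eq_of_inner {S T : Adjointable A E}
    (h : ∀ x y, inner A (S x) y = inner A x (T y)) : star T = S :=
  ext_of_inner fun x y => by
    rw [inner_star_right, ← CStarModule.star_inner, ← h, CStarModule.star_inner]

theorem star_mk_apply (T S : E →L[ℂ] E) (h : ∀ x y, inner A (S x) y = inner A x (T y)) (x : E) :
    (star (mk T S h) : Adjointable A E) x = S x := by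
  rw [star_eq_of_inner (T := mk T S h)
    (S := mk S T fun x y => CStarModule.inner_comm_adjoint h x y) h, mk_apply]

@[simp] theorem one_apply (x : E) : (1 : Adjointable A E) x = x := rfl

/-- The operator `U T V`, for maps `U : E → F` and `V : F → E` that are adjoint to each other. -/
def conj (U : E →L[ℂ] F) (V : F →L[ℂ] E) (h : ∀ y x, inner A (V y) x = inner A y (U x)) :
    Adjointable A E →ₗ[ℂ] Adjointable A F where
  toFun T := mk (U.comp ((toCLM A E T).comp V)) (U.comp ((toCLM A E (star T)).comp V)) fun x y => by
    simp only [ContinuousLinearMap.comp_apply]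
    rw [CStarModule.inner_comm_adjoint h, inner_star_left, h]
  map_add' S T := ext fun x => map_add U _ _
  map_smul' c T := ext fun x => map_smul U c _

variable {U : E →L[ℂ] F} {V : F →L[ℂ] E} (h : ∀ y x, inner A (V y) x = inner A y (U x))

@[simp] theorem conj_apply (T : Adjointable A E) (y : F) : conj U V h T y = U (T (V y)) := rfl

theorem continuous_conj : Continuous (conj U V h) := by
  refine continuous_induced_rng.2 ?_
  change Continuous fun T : Adjointable A E => U.comp ((toCLM A E T).comp V)
  have : Continuous (toCLM A E) := continuous_subtype_val
  exact continuous_const.clm_comp (this.clm_comp continuous_const)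

theorem star_conj (T : Adjointable A E) : star (conj U V h T) = conj U V h (star T) :=
  star_eq_of_inner fun x y => by
    rw [conj_apply, conj_apply, CStarModule.inner_comm_adjoint h, inner_star_left, h]

theorem isStarProjection_conj_one (hVU : ∀ x, V (U x) = x) :
    IsStarProjection (conj U V h 1) where
  isIdempotentElem := ext fun x => by simp [hVU]
  isSelfAdjoint := by
    rw [IsSelfAdjoint, star_conj, star_one]

/-- `conj U V` as a `⋆`-homomorphism, if `U` is an isometry, i.e. `V U = 1`. -/
def conjHom (hVU : ∀ x, V (U x) = x) : Adjointable A E →⋆ₙₐ[ℂ] Adjointable A F :=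
  { conj U V h with
    map_zero' := map_zero (conj U V h)
    map_mul' := fun S T => ext fun x => by
      change U ((S * T) (V x)) = U (S (V (U (T (V x)))))
      rw [hVU, mul_apply]
    map_star' := fun T => (star_conj h T).symm }

theorem conj_conj (hVU : ∀ x, V (U x) = x) (h' : ∀ x y, inner A (U x) y = inner A x (V y))
    (T : Adjointable A E) : conj V U h' (conj U V h T) = T :=
  ext fun x => by simp [hVU]

theorem conj_conj_eq_mul (h' : ∀ x y, inner A (U x) y = inner A x (V y))
    (T : Adjointable A F) : conj U V h (conj V U h' T) = conj U V h 1 * T * conj U V h 1 :=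
  ext fun x => by simp

/-- A projection fixes its range, so `Q Q' = Q'` and `Q' Q = Q`. The adjoint of the first identity
is `Q' Q = Q'`, and the two together give `Q = Q'`. -/
theorem eq_of_isStarProjection_of_range_eq {Q Q' : Adjointable A E} (hQ : IsStarProjection Q)
    (hQ' : IsStarProjection Q') (hr : Set.range Q = Set.range Q') : Q = Q' := by
  have key {Q Q' : Adjointable A E} (hQ : IsStarProjection Q)
      (hr : Set.range Q' ⊆ Set.range Q) : Q * Q' = Q' := ext fun x => by
    obtain ⟨y, hy⟩ := hr ⟨x, rfl⟩
    rw [mul_apply, ← hy, ← mul_apply, hQ.isIdempotentElem.eq]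
  have h1 := key hQ hr.ge
  have h2 := key hQ' hr.le
  have h3 := congrArg star h1
  rw [star_mul, hQ.isSelfAdjoint.star_eq, hQ'.isSelfAdjoint.star_eq] at h3
  exact h2.symm.trans h3

theorem subset_cstarGenerated (S : Set (Adjointable A E)) : S ⊆ cstarGenerated S :=
  (NonUnitalStarAlgebra.subset_adjoin ℂ S).trans
    (NonUnitalStarSubalgebra.le_topologicalClosure _)

theorem isClosed_cstarGenerated (S : Set (Adjointable A E)) :
    IsClosed (cstarGenerated S : Set (Adjointable A E)) :=
  NonUnitalStarSubalgebra.isClosed_topologicalClosure _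

theorem cstarGenerated_le {S : Set (Adjointable A E)}
    {B : NonUnitalStarSubalgebra ℂ (Adjointable A E)} (hS : S ⊆ B)
    (hB : IsClosed (B : Set (Adjointable A E))) : cstarGenerated S ≤ B :=
  NonUnitalStarSubalgebra.topologicalClosure_minimal _ (NonUnitalStarAlgebra.adjoin_le hS) hB

/-- If `U` is an isometry with adjoint `V`, then the `C⋆`-algebra generated by `S` is isomorphic to
the `C⋆`-algebra generated by the compressions `Q T Q` of the elements `T` of `C` to the range of
`U`, provided that each contains the generators of the other. -/
theorem nonempty_equiv_cstarGenerated_compression (hVU : ∀ x, V (U x) = x)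
    (h' : ∀ x y, inner A (U x) y = inner A x (V y))
    (S : Set (Adjointable A E)) (C : Set (Adjointable A F))
    (hS : ∀ s ∈ S, ∃ T ∈ C, conj V U h' T = s)
    (hC : ∀ T ∈ C, conj V U h' T ∈ cstarGenerated S) :
    Nonempty (cstarGenerated S ≃⋆ₐ[ℂ]
      cstarGenerated {R | ∃ T ∈ C, R = conj U V h 1 * T * conj U V h 1}) := by
  set B := cstarGenerated {R | ∃ T ∈ C, R = conj U V h 1 * T * conj U V h 1}
  -- A generator of the form `s = V T U` goes to `U V T U V`, which is `Q T Q` for `Q = U V`.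
  have h1 : cstarGenerated S ≤ B.comap (conjHom h hVU) := by
    refine cstarGenerated_le (fun s hs => ?_)
      ((isClosed_cstarGenerated _).preimage (continuous_conj h))
    obtain ⟨T, hT, rfl⟩ := hS s hs
    exact subset_cstarGenerated _ ⟨T, hT, conj_conj_eq_mul h h' T⟩
  have h2 : B ≤ (cstarGenerated S).map (conjHom h hVU) := by
    -- The image consists of all `b` that are fixed by `b ↦ U V b U V` and satisfy `V b U ∈ C⋆(S)`.
    -- Both conditions are closed, so the image is closed and it suffices to check generators.
    have e : ((cstarGenerated S).map (conjHom h hVU) : Set (Adjointable A F)) =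
        conj V U h' ⁻¹' cstarGenerated S ∩ {b | conj U V h (conj V U h' b) = b} := by
      ext b
      constructor
      · rintro ⟨a, ha, rfl⟩
        have e := conj_conj h hVU h' a
        exact ⟨(congrArg (· ∈ cstarGenerated S) e).mpr ha, congrArg (conj U V h) e⟩
      · rintro ⟨hb, hb'⟩
        exact ⟨_, hb, hb'⟩
    refine cstarGenerated_le ?_ ?_
    · rintro _ ⟨T, hT, rfl⟩
      exact ⟨_, hC T hT, conj_conj_eq_mul h h' T⟩
    · rw [e]
      exact ((isClosed_cstarGenerated _).preimage (continuous_conj h')).inter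
        (isClosed_eq ((continuous_conj h).comp (continuous_conj h')) continuous_id)
  refine ⟨StarAlgEquiv.ofBijective
    (NonUnitalStarAlgHom.codRestrict ((conjHom h hVU).comp
      (NonUnitalStarSubalgebraClass.subtype (cstarGenerated S))) B fun s => h1 s.2) ⟨?_, ?_⟩⟩
  · intro a b hab
    have := congrArg (fun t : B => conj V U h' t.1) hab
    exact Subtype.ext ((conj_conj h hVU h' a.1).symm.trans (this.trans (conj_conj h hVU h' b.1)))
  · rintro ⟨b, hb⟩
    obtain ⟨a, ha, rfl⟩ := h2 hb
    exact ⟨⟨a, ha⟩, rfl⟩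

end Adjointable
end Compression

theorem Adjointable.star_restrict_apply {A E : Type*} [CStarAlgebra A] [PartialOrder A]
    [StarOrderedRing A] [NormedAddCommGroup E] [NormedSpace ℂ E] [Module A E] [IsScalarTower ℂ A E]
    [CStarModule A E] (N : Submodule A E) (T S : E →L[ℂ] E)
    (hST : ∀ x y, inner A (S x) y = inner A x (T y))
    (hT : ∀ x ∈ N, T x ∈ N) (hS : ∀ x ∈ N, S x ∈ N) (x : N) :
    ((star (Adjointable.restrict N T S hST hT hS) : Adjointable A N) x : E) = S x := by
  rw [restrict, star_mk_apply]
  rfl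

/-! ### Cocycle identities for the groupoid and the maps `V_g` -/

namespace InjectiveAction

variable {G X : Type*} [Group G] [TopologicalSpace X] {P : Submonoid G} (θ : InjectiveAction P X)
  [IsRightOre P]

theorem u_coe (x : X) (m : P) : θ.u x (m : G) = θ m x := by
  have h : θ m x = θ 1 (θ m x) := (θ.one' _).symm
  simpa using θ.u_eq h

theorem u_mul {x : X} {g k : G} (hg : g ∈ θ.Q x) (hk : k ∈ θ.Q (θ.u x g)) :
    θ.u x (g * k) = θ.u (θ.u x g) k := by
  obtain ⟨y, a, b, rfl, hy⟩ := hg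
  rw [θ.u_eq hy] at hk ⊢
  obtain ⟨z, c, d, rfl, hz⟩ := hk
  rw [θ.u_eq hz]
  -- Common denominators: writing `b⁻¹ c = m n⁻¹` turns `(a b⁻¹)(c d⁻¹)` into the fraction `(a m)(d
  -- n)⁻¹`, to which `u_eq` applies.
  obtain ⟨m, n, hmn⟩ := IsRightOre.exists_eq_mul_inv (P := P) ((b : G)⁻¹ * c)
  have h1 : c * n = b * m := Subtype.ext <| by
    have := congrArg (fun t => (b : G) * t * n) hmn
    simpa [mul_assoc] using this
  have h2 : (a : G) * (b : G)⁻¹ * (c * (d : G)⁻¹) = (a * m : P) * ((d * n : P) : G)⁻¹ := by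
    calc (a : G) * (b : G)⁻¹ * (c * (d : G)⁻¹) = a * ((b : G)⁻¹ * c) * (d : G)⁻¹ := by group
      _ = _ := by rw [hmn]; push_cast; group
  rw [h2]
  apply θ.u_eq
  rw [← θ.comp', hy, θ.comp', ← h1, ← θ.comp', hz, θ.comp']

theorem mem_Q_u_iff {x : X} {g k : G} (hg : g ∈ θ.Q x) : k ∈ θ.Q (θ.u x g) ↔ g * k ∈ θ.Q x :=
  ⟨θ.mul_mem_Q hg, fun h => by simpa using θ.inv_mul_mem_Q hg h⟩

section Compact

variable [CompactSpace X] [T2Space X]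

/-- For `m ∈ P` the partial map `x ↦ u(x, m)` is defined everywhere and equals `θ_m`. This is how
the dual action appears in compressions. -/
theorem V_coe (m : P) (f : C(X, ℂ)) : θ.V m f = θ.dual m f := by
  ext x
  rw [θ.V_apply (θ.mem_Q_of_mem x m), θ.u_coe]
  rfl

/-- The assumption `g ∈ Q_x` matters: otherwise the left side is `0`, while `g k` may still belong
to `Q_x`. Thus `V` is only a partial action. -/
theorem V_mul_apply {x : X} {g : G} (hg : g ∈ θ.Q x) (k : G) (f : C(X, ℂ)) :
    θ.V g (θ.V k f) x = θ.V (g * k) f x := by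
  rw [θ.V_apply hg]
  by_cases hk : k ∈ θ.Q (θ.u x g)
  · rw [θ.V_apply hk, θ.V_apply (θ.mul_mem_Q hg hk), θ.u_mul hg hk]
  · rw [θ.V_apply_of_notMem hk, θ.V_apply_of_notMem fun h => hk ((θ.mem_Q_u_iff hg).2 h)]

theorem V_star (g : G) (f : C(X, ℂ)) : θ.V g (star f) = star (θ.V g f) := by
  ext x
  by_cases hg : g ∈ θ.Q x
  · simp [θ.V_apply hg]
  · simp [θ.V_apply_of_notMem hg]

end Compact

variable [CompactSpace X] [T2Space X] [TopologicalSpace G] [DiscreteTopology G]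

/-! ### Finitely supported families and the submodule `𝓜` -/

theorem isClosed_groupoid : IsClosed θ.groupoid := by
  rw [← isOpen_compl_iff]
  refine isOpen_iff_mem_nhds.2 fun p hp => ?_
  refine Filter.mem_of_superset (prod_mem_nhds
    ((θ.isClopen_setOf_mem_Q p.2).compl.isOpen.mem_nhds hp) (t := {p.2}) (by simp)) ?_
  rintro ⟨x, g⟩ ⟨hx, rfl⟩
  exact hx

/-- Every finitely supported family of functions `η g`, where `η g` vanishes off the set of all `x`
with `g ∈ Q_x`, comes from an element of `C_c(X ⋊ P)`. -/
theorem exists_coeff_eq (η : G → C(X, ℂ)) (t : Finset G) (ht : ∀ g ∉ t, η g = 0)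
    (h : ∀ (x : X) (g : G), g ∉ θ.Q x → η g x = 0) : ∃ ξ : C_c(θ.groupoid, ℂ),
      θ.coeff ξ = η ∧ ∀ p, ξ p = η p.1.2 p.1.1 := by
  have hcont : Continuous fun p : θ.groupoid => η p.1.2 p.1.1 := by
    have : Continuous fun p : X × G => η p.2 p.1 :=
      continuous_prod_of_discrete_right.2 fun g => (η g).continuous
    exact this.comp continuous_subtype_val
  refine ⟨⟨⟨_, hcont⟩, ?_⟩, ?_, fun p => rfl⟩
  · refine HasCompactSupport.intro (K := Subtype.val ⁻¹' (Set.univ ×ˢ (t : Set G))) ?_ ?_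
    · exact θ.isClosed_groupoid.isClosedEmbedding_subtypeVal.isCompact_preimage
        (isCompact_univ.prod t.finite_toSet.isCompact)
    · intro p hp
      have : p.1.2 ∉ t := fun hpt => hp ⟨trivial, hpt⟩
      simp [ht _ this]
  · exact θ.coeff_ext (fun x g hg => rfl) h

theorem continuous_eval_apply {I : Type*} (i : I) (x : X) :
    Continuous fun ξ : L2 I X => ξ i x := by
  refine Continuous.comp (g := fun f : C(X, ℂ) => f x) (by fun_prop) ?_
  refine Metric.continuous_iff.2 fun ξ ε hε => ⟨ε, hε, fun η h => ?_⟩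
  rw [dist_eq_norm] at h ⊢
  exact (L2.norm_apply_le (η - ξ) i).trans_lt h

/-- Evaluations are continuous, so the vanishing condition survives closure. Conversely, truncation
to finitely many indices keeps all vanishing conditions, yields an element of `C_c`, and
approximates in norm. -/
theorem mem_M_iff (ζ : θ.l2Groupoid) : ζ ∈ θ.M ↔ ∀ g ∉ P, ζ.1 g = 0 := by
  constructor
  · intro hζ g hg
    ext x
    have hs : IsClosed {ζ : θ.l2Groupoid | ζ.1 g x = 0} :=
      isClosed_eq ((continuous_eval_apply g x).comp continuous_subtype_val) continuous_const
    refine closure_minimal ?_ hs hζ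
    rintro ζ ⟨ξ, hξ, hζ⟩
    rw [Set.mem_ofPred_eq, hζ, toL2_apply]
    by_cases hx : g ∈ θ.Q x
    · rw [θ.coeff_apply ξ hx, hξ _ hg]
    · exact θ.coeff_apply_of_notMem ξ hx
  · intro h
    refine Metric.mem_closure_iff.2 fun ε hε => ?_
    obtain ⟨t, η, ht, ht', hη⟩ := L2.exists_finite_approx ζ.1 hε
    have h1 (g : G) (hg : ζ.1 g = 0) : η g = 0 := by
      by_cases hgt : g ∈ t
      · rw [ht g hgt, hg]
      · exact ht' g hgt
    have h2 (x : X) (g : G) (hx : g ∉ θ.Q x) : η g x = 0 := by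
      by_cases hgt : g ∈ t
      · rw [ht g hgt, (θ.mem_l2Groupoid_iff _).1 ζ.2 g x hx]
      · rw [ht' g hgt]
        rfl
    obtain ⟨ξ, hξ, hξ'⟩ := θ.exists_coeff_eq η t ht' h2
    refine ⟨⟨η, (θ.mem_l2Groupoid_iff _).2 fun g x hx => h2 x g hx⟩, ⟨ξ, fun p hp => ?_, ?_⟩, ?_⟩
    · rw [hξ', h1 _ (h _ hp)]
      rfl
    · exact L2.ext fun g => (congrFun hξ g).symm
    · rw [Subtype.dist_eq, dist_eq_norm]
      exact hη

/-! ### The isometry of `ℓ²(P, C(X))` onto `𝓜` and the projection onto `𝓜` -/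

/-- The isometry `ℓ²(P, C(X)) → ℓ²(X ⋊ P)` that extends families by zero. -/
def embed : L2 P X →L[ℂ] θ.l2Groupoid where
  toFun ξ := ⟨L2.push Subtype.val Subtype.val_injective ξ, (θ.mem_l2Groupoid_iff _).2 fun g x hg => by
    rw [L2.push_apply_of_notMem]
    · rfl
    · rintro ⟨m, rfl⟩
      exact hg (θ.mem_Q_of_mem x m)⟩
  map_add' ξ η := Subtype.ext (map_add _ ξ η)
  map_smul' c ξ := Subtype.ext (map_smul _ c ξ)
  cont := (L2.push _ _).continuous.subtype_mk _

/-- The restriction `ℓ²(X ⋊ P) → ℓ²(P, C(X))` of families to `P`. -/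
def restr : θ.l2Groupoid →L[ℂ] L2 P X where
  toFun ζ := L2.mulPull Subtype.val Subtype.val_injective (fun _ => 1) ‖(1 : C(X, ℂ))‖
    (norm_nonneg _) (fun _ => le_rfl) ζ.1
  map_add' ξ η := map_add _ ξ.1 η.1
  map_smul' c ξ := map_smul _ c ξ.1
  cont := (L2.mulPull _ _ _ _ _ _).continuous.comp continuous_subtype_val

@[simp] theorem embed_apply_coe (ξ : L2 P X) (m : P) : (θ.embed ξ).1 (m : G) = ξ m :=
  L2.push_apply Subtype.val Subtype.val_injective ξ m

theorem embed_apply_of_notMem (ξ : L2 P X) {g : G} (hg : g ∉ P) : (θ.embed ξ).1 g = 0 :=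
  L2.push_apply_of_notMem Subtype.val Subtype.val_injective ξ g (by rintro ⟨m, rfl⟩; exact hg m.2)

@[simp] theorem restr_apply (ζ : θ.l2Groupoid) (m : P) : θ.restr ζ m = ζ.1 m := one_mul _

@[simp] theorem restr_embed (ξ : L2 P X) : θ.restr (θ.embed ξ) = ξ := L2.ext fun m => by simp

theorem inner_embed (ξ : L2 P X) (ζ : θ.l2Groupoid) :
    inner C(X, ℂ) (θ.embed ξ) ζ = inner C(X, ℂ) ξ (θ.restr ζ) := by
  refine (L2.inner_push Subtype.val Subtype.val_injective ξ ζ.1).trans ?_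
  rw [L2.inner_def]
  simp

theorem inner_restr (ζ : θ.l2Groupoid) (ξ : L2 P X) :
    inner C(X, ℂ) (θ.restr ζ) ξ = inner C(X, ℂ) ζ (θ.embed ξ) :=
  CStarModule.inner_comm_adjoint θ.inner_embed ζ ξ

theorem embed_mem_M (ξ : L2 P X) : θ.embed ξ ∈ θ.M :=
  (θ.mem_M_iff _).2 fun _ hg => θ.embed_apply_of_notMem ξ hg

theorem embed_restr {ζ : θ.l2Groupoid} (hζ : ζ ∈ θ.M) : θ.embed (θ.restr ζ) = ζ :=
  Subtype.ext <| L2.ext fun g => by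
    by_cases hg : g ∈ P
    · exact (θ.embed_apply_coe _ ⟨g, hg⟩).trans (θ.restr_apply _ _)
    · rw [θ.embed_apply_of_notMem _ hg, (θ.mem_M_iff ζ).1 hζ g hg]

/-- The isomorphism of Hilbert modules between `𝓜` and `ℓ²(P, C(X))`. -/
def equivM : θ.M ≃ₗ[C(X, ℂ)] L2 P X where
  toFun ζ := θ.restr ζ
  invFun ξ := ⟨θ.embed ξ, θ.embed_mem_M ξ⟩
  map_add' ζ₁ ζ₂ := map_add _ _ _
  map_smul' f ζ := L2.ext fun m => by
    rw [restr_apply, RingHom.id_apply, L2.cmul_apply, restr_apply]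
    rfl
  left_inv ζ := Subtype.ext (θ.embed_restr ζ.2)
  right_inv ξ := θ.restr_embed ξ

theorem inner_equivM (ζ₁ ζ₂ : θ.M) :
    inner C(X, ℂ) (θ.equivM ζ₁) (θ.equivM ζ₂) = inner C(X, ℂ) ζ₁ ζ₂ := by
  change inner C(X, ℂ) (θ.restr ζ₁) (θ.restr ζ₂) = inner C(X, ℂ) ζ₁.1 ζ₂.1
  rw [inner_restr, θ.embed_restr ζ₂.2]

/-- The projection of `ℓ²(X ⋊ P)` onto `𝓜`. -/
def projM : Adjointable C(X, ℂ) θ.l2Groupoid :=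
  Adjointable.conj θ.embed θ.restr θ.inner_restr 1

theorem isStarProjection_projM : IsStarProjection θ.projM :=
  Adjointable.isStarProjection_conj_one _ θ.restr_embed

theorem range_projM : Set.range θ.projM = (θ.M : Set θ.l2Groupoid) := by
  ext ζ
  constructor
  · rintro ⟨ζ, rfl⟩
    exact θ.embed_mem_M _
  · exact fun hζ => ⟨ζ, θ.embed_restr hζ⟩

/-! ### Monomial operators -/

/-- `T` is the operator `(T ξ)(x, g) = h(u(x, g)) ξ(x, g k)`, with the value `0` if `g ∉ Q_x`. -/
def IsMonomial (k : G) (h : C(X, ℂ)) (T : Adjointable C(X, ℂ) θ.l2Groupoid) : Prop :=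
  ∀ (ξ : θ.l2Groupoid) (g : G) (x : X), (T ξ).1 g x = θ.V g h x * ξ.1 (g * k) x

variable {θ}

theorem IsMonomial.apply {k : G} {h : C(X, ℂ)} {T : Adjointable C(X, ℂ) θ.l2Groupoid}
    (hT : θ.IsMonomial k h T) (ξ : θ.l2Groupoid) (g : G) :
    (T ξ).1 g = θ.V g h * ξ.1 (g * k) :=
  ContinuousMap.ext (hT ξ g)

/-- Applying `T` at the index `g k` produces the factor `V_{gk} h`, which on the domain of `V_g`
equals `V_g (V_k h)` and so merges with `V_g f`. Off that domain both sides vanish. -/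
theorem IsMonomial.mul {k l : G} {f h : C(X, ℂ)} {S T : Adjointable C(X, ℂ) θ.l2Groupoid}
    (hS : θ.IsMonomial k f S) (hT : θ.IsMonomial l h T) :
    θ.IsMonomial (k * l) (f * θ.V k h) (S * T) := fun ξ g x => by
  rw [Adjointable.mul_apply, hS, hT, mul_assoc]
  by_cases hg : g ∈ θ.Q x
  · rw [← mul_assoc, ← mul_assoc, ← θ.V_mul_apply hg, θ.V_apply hg, θ.V_apply hg, θ.V_apply hg]
    rfl
  · simp [θ.V_apply_of_notMem hg]

variable (θ) in
theorem regularPart_isMonomial (f : C_c(θ.groupoid, ℂ)) (k : G) :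
    θ.IsMonomial k (θ.coeff f k) (θ.regularPart f k) := fun _ _ _ => rfl

theorem regularPart_star_isMonomial (f : C_c(θ.groupoid, ℂ)) (k : G) :
    θ.IsMonomial k⁻¹ (θ.V k⁻¹ (star (θ.coeff f k))) (star (θ.regularPart f k)) := by
  intro ξ g x
  by_cases hg : g ∈ θ.Q x
  · rw [θ.V_mul_apply hg, θ.V_star]
    -- The adjoint transports entries along `g ↦ g k`, so its value is read off at an index written
    -- in that form.
    obtain ⟨g, rfl⟩ : ∃ g', g' * k = g := ⟨g * k⁻¹, by group⟩
    rw [mul_inv_cancel_right]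
    rw [← ContinuousMap.mul_apply]
    refine DFunLike.congr_fun ?_ x
    exact (congrArg (fun η : L2 G X => η (g * k)) (Adjointable.star_restrict_apply _ _ _ _ _ _ ξ)).trans
      (L2.push_apply _ (mul_left_injective k) _ g)
  · rw [θ.V_apply_of_notMem hg, zero_mul]
    exact (θ.mem_l2Groupoid_iff _).1 (Subtype.property _) g x hg

/-- Each `π̃(f)` is a finite sum of parts `regularPart f k`. The `⋆`-algebra generated by these
parts is the linear span of the words in them and their adjoints, and every such word is a monomial.
-/
theorem mem_span_isMonomial {T : Adjointable C(X, ℂ) θ.l2Groupoid}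
    (hT : T ∈ NonUnitalStarAlgebra.adjoin ℂ (Set.range θ.regular)) :
    T ∈ Submodule.span ℂ {T | ∃ k h, θ.IsMonomial k h T} := by
  let R : Set (Adjointable C(X, ℂ) θ.l2Groupoid) := {T | ∃ f k, θ.regularPart f k = T}
  have h1 : NonUnitalStarAlgebra.adjoin ℂ (Set.range θ.regular) ≤
      NonUnitalStarAlgebra.adjoin ℂ R := by
    refine NonUnitalStarAlgebra.adjoin_le ?_
    rintro _ ⟨f, rfl⟩
    exact sum_mem fun k _ => NonUnitalStarAlgebra.subset_adjoin ℂ R ⟨f, k, rfl⟩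
  have h2 : T ∈ (NonUnitalStarAlgebra.adjoin ℂ R).toSubmodule := h1 hT
  rw [NonUnitalStarAlgebra.adjoin_eq_span] at h2
  refine Submodule.span_mono (fun S hS => ?_) h2
  induction hS using Subsemigroup.closure_induction with
  | mem S hS =>
    rcases hS with ⟨f, k, rfl⟩ | ⟨f, k, hS⟩
    · exact ⟨_, _, θ.regularPart_isMonomial f k⟩
    · rw [← star_star S, ← hS]
      exact ⟨_, _, regularPart_star_isMonomial f k⟩
  | mul S T _ _ hS hT =>
    obtain ⟨_, _, hS⟩ := hS
    obtain ⟨_, _, hT⟩ := hT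
    exact ⟨_, _, hS.mul hT⟩

variable (θ) in
-- The function on the groupoid is `h` placed over the single group element `k`, so only the term at
-- `g k` survives in the sum defining `π̃`. By `hk`, no information about `h` is lost in restricting
-- it to the groupoid.
theorem exists_regular_isMonomial {k : G} {h : C(X, ℂ)} (hk : ∀ x, k ∉ θ.Q x → h x = 0) :
    ∃ f, θ.IsMonomial k h (θ.regular f) := by
  classical
  obtain ⟨f, hf, -⟩ := θ.exists_coeff_eq (Pi.single k h) {k} (fun g hg => by
    simp_all) fun x g hg => by
      by_cases hgk : g = k
      · subst hgk
        simpa using hk x hg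
      · simp [hgk]
  refine ⟨f, fun ξ g x => ?_⟩
  by_cases hg : g ∈ θ.Q x
  · rw [θ.regular_apply f ξ hg, θ.V_apply hg]
    have e (l : θ.Q x) : f ⟨(θ.u x g, g⁻¹ * l), θ.inv_mul_mem_Q hg l.2⟩ =
        (Pi.single k h : G → C(X, ℂ)) (g⁻¹ * l) (θ.u x g) := by
      rw [← θ.coeff_apply f (θ.inv_mul_mem_Q hg l.2), hf]
    simp only [e]
    by_cases hgk : g * k ∈ θ.Q x
    · rw [tsum_eq_single ⟨g * k, hgk⟩]
      · simp
      · rintro ⟨l, hl⟩ hlk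
        have : g⁻¹ * l ≠ k := by
          rintro rfl
          simp at hlk
        simp [this]
    -- Here the sum over `Q_x` has no term at `g k`, and accordingly the entry `ξ(x, g k)` is zero.
    · rw [(θ.mem_l2Groupoid_iff _).1 ξ.2 _ _ hgk, mul_zero]
      refine (tsum_congr fun l => ?_).trans tsum_zero
      have : g⁻¹ * (l : G) ≠ k := by
        rintro rfl
        simp at hgk
      simp [this]
  · rw [θ.V_apply_of_notMem hg, zero_mul]
    exact (θ.mem_l2Groupoid_iff _).1 (Subtype.property _) g x hg

/-! ### Compressions of monomials and the crossed product -/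

theorem star_v_apply (m n : P) (ξ : L2 P X) :
    (star (v X m) : Adjointable C(X, ℂ) (L2 P X)) ξ n = ξ (n * m) := by
  rw [v, Adjointable.star_mk_apply]
  exact one_mul _

/-- At `n ∈ P` the coefficient `V_n h` is `α_n(h)`, and the shifted index is `n a b⁻¹`: `v_a⋆` moves
`n` to `n a`, then `v_b` moves `n a` to `n a b⁻¹`. The value `0` that `v_b` gives when this leaves
`P` is the extension by zero in `embed`. -/
theorem IsMonomial.compression {a b : P} {h : C(X, ℂ)}
    {T : Adjointable C(X, ℂ) θ.l2Groupoid} (hT : θ.IsMonomial (a * (b : G)⁻¹) h T) :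
    Adjointable.conj θ.restr θ.embed θ.inner_embed T =
      θ.piRep h * (star (v X a) * v X b) := by
  classical
  refine Adjointable.ext fun ξ => L2.ext fun n => ?_
  rw [Adjointable.conj_apply, restr_apply, hT.apply, θ.V_coe, Adjointable.mul_apply, piRep_apply,
    Adjointable.mul_apply, star_v_apply, v_apply]
  congr 1
  have e : (n : G) * (a * (b : G)⁻¹) = (n * a : P) * (b : G)⁻¹ := by
    push_cast
    group
  rw [e]
  split_ifs with hn
  · exact θ.embed_apply_coe ξ ⟨_, hn⟩
  · exact θ.embed_apply_of_notMem ξ hn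

/-- Compression is linear and continuous but not multiplicative, so generators alone would not
suffice; a spanning set of a dense subspace does, and the monomials provide it. -/
theorem compression_mem {T : Adjointable C(X, ℂ) θ.l2Groupoid}
    (hT : T ∈ θ.reducedGroupoidCStar) :
    Adjointable.conj θ.restr θ.embed θ.inner_embed T ∈ θ.reducedCrossedProduct := by
  have hc : IsClosed (Adjointable.conj θ.restr θ.embed θ.inner_embed ⁻¹'
      (θ.reducedCrossedProduct : Set (Adjointable C(X, ℂ) (L2 P X)))) :=
    (Adjointable.isClosed_cstarGenerated _).preimage (Adjointable.continuous_conj _)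
  refine closure_minimal (fun S hS => ?_) hc hT
  refine Submodule.span_le (p := θ.reducedCrossedProduct.toSubmodule.comap
    (Adjointable.conj θ.restr θ.embed θ.inner_embed)).2 ?_ (mem_span_isMonomial hS)
  rintro R ⟨k, h, hR⟩
  obtain ⟨a, b, rfl⟩ := IsRightOre.exists_eq_mul_inv (P := P) k
  change _ ∈ θ.reducedCrossedProduct
  rw [hR.compression]
  have hπ : θ.piRep h ∈ θ.reducedCrossedProduct :=
    Adjointable.subset_cstarGenerated _ (Or.inl ⟨h, rfl⟩)
  have hv (m : P) : v X m ∈ θ.reducedCrossedProduct :=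
    Adjointable.subset_cstarGenerated _ (Or.inr ⟨m, rfl⟩)
  exact mul_mem hπ (mul_mem (star_mem (hv a)) (hv b))

theorem regular_mem (f : C_c(θ.groupoid, ℂ)) : θ.regular f ∈ θ.reducedGroupoidCStar :=
  Adjointable.subset_cstarGenerated _ ⟨f, rfl⟩

variable (θ) in
theorem exists_compression_eq_piRep (f : C(X, ℂ)) : ∃ T ∈ θ.reducedGroupoidCStar,
    Adjointable.conj θ.restr θ.embed θ.inner_embed T = θ.piRep f := by
  -- The identity is written as a fraction so that the compression formula applies; it gives `π(f)
  -- v_1⋆ v_1 = π(f)`.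
  obtain ⟨F, hF⟩ := θ.exists_regular_isMonomial (k := ((1 : P) : G) * ((1 : P) : G)⁻¹) (h := f)
    fun x hx => absurd ((θ.mem_Q_iff x 1 1).2 ⟨x, rfl⟩) hx
  refine ⟨_, regular_mem F, ?_⟩
  rw [hF.compression]
  refine Adjointable.ext fun ξ => L2.ext fun n => ?_
  classical
  simp [piRep_apply, star_v_apply, v_apply]

variable (θ) in
theorem exists_compression_eq_v (m : P) : ∃ T ∈ θ.reducedGroupoidCStar,
    Adjointable.conj θ.restr θ.embed θ.inner_embed T = v X m := by
  -- The coefficient is `V_{m⁻¹} 1`, the indicator function of `θ_m(X)`; the constant `1` need not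
  -- vanish where `m⁻¹ ∉ Q_x`. The compression is then `π(V_{m⁻¹} 1) v_m`.
  obtain ⟨F, hF⟩ := θ.exists_regular_isMonomial (k := ((1 : P) : G) * (m : G)⁻¹)
    (h := θ.V (((1 : P) : G) * (m : G)⁻¹) 1) fun x hx => θ.V_apply_of_notMem hx _
  refine ⟨_, regular_mem F, ?_⟩
  rw [hF.compression]
  refine Adjointable.ext fun ξ => L2.ext fun n => ?_
  classical
  rw [Adjointable.mul_apply, piRep_apply, Adjointable.mul_apply, star_v_apply, mul_one, v_apply]
  split_ifs with hn
  · ext x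
    rw [ContinuousMap.mul_apply]
    -- The indicator has no effect after `v_m`: an index that `v_m` reaches has the form `n = p m`
    -- with `p ∈ P`, so `θ_n(x) = θ_m(θ_p(x))` lies in `θ_m(X)`.
    have hx : ((1 : P) : G) * (m : G)⁻¹ ∈ θ.Q (θ n x) := by
      refine (θ.mem_Q_iff _ _ _).2 ⟨θ ⟨_, hn⟩ x, ?_⟩
      rw [θ.one', θ.comp']
      exact congrArg (fun p : P => θ p x) (Subtype.ext (by simp))
    have : θ.dual n (θ.V (((1 : P) : G) * (m : G)⁻¹) 1) x = 1 := θ.V_apply hx 1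
    rw [this, one_mul]
  · exact mul_zero _

end InjectiveAction
end

theorem theorem2p9 {G X : Type*} [Group G] [Countable G] [TopologicalSpace G] [DiscreteTopology G]
    [TopologicalSpace X] [CompactSpace X] [T2Space X] [SecondCountableTopology X]
    (P : Submonoid G) [IsRightOre P] (θ : InjectiveAction P X) :
    (∃ Λ : θ.M ≃ₗ[C(X, ℂ)] L2 P X,
      ∀ ζ₁ ζ₂ : θ.M, inner C(X, ℂ) (Λ ζ₁) (Λ ζ₂) = inner C(X, ℂ) ζ₁ ζ₂) ∧
    (∃! Q : Adjointable C(X, ℂ) θ.l2Groupoid,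
      IsStarProjection Q ∧ Set.range Q = (θ.M : Set θ.l2Groupoid)) ∧
    ∀ Q : Adjointable C(X, ℂ) θ.l2Groupoid,
      IsStarProjection Q → Set.range Q = (θ.M : Set θ.l2Groupoid) →
      Nonempty (θ.reducedCrossedProduct ≃⋆ₐ[ℂ]
        cstarGenerated {S | ∃ T ∈ θ.reducedGroupoidCStar, S = Q * T * Q}) := by
  have unique (Q : Adjointable C(X, ℂ) θ.l2Groupoid) (hQ : IsStarProjection Q)
      (hr : Set.range Q = (θ.M : Set θ.l2Groupoid)) : Q = θ.projM :=
    Adjointable.eq_of_isStarProjection_of_range_eq hQ θ.isStarProjection_projM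
      (hr.trans θ.range_projM.symm)
  refine ⟨⟨θ.equivM, θ.inner_equivM⟩, ⟨θ.projM, ⟨θ.isStarProjection_projM, θ.range_projM⟩,
    fun Q hQ => unique Q hQ.1 hQ.2⟩, fun Q hQ hr => ?_⟩
  -- With `Q` replaced by `projM`, which unfolds to the conjugate of `1` by `embed`, the goal has
  -- the shape of the abstract compression lemma.
  obtain rfl := unique Q hQ hr
  refine Adjointable.nonempty_equiv_cstarGenerated_compression θ.inner_restr θ.restr_embed
    θ.inner_embed _ _ ?_ fun T hT => InjectiveAction.compression_mem hT
  rintro _ (⟨f, rfl⟩ | ⟨m, rfl⟩)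
  · exact θ.exists_compression_eq_piRep f
  · exact θ.exists_compression_eq_v m
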